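/- For every $\kappa \ge 1$ there exist constants $C_0, C_1 > 0$, depending only on $\kappa$, such that the following holds. Let $n,d\ge 0$, $k,K\ge 0$ be integers with $3k+K\le d$, and let $\sigma,\omega>0$, $\gamma\ge 0$. Let $A=(a_{ij})$ be a random $n\times d$ real matrix with rows $a_1,\dots,a_n$, whose entries are i.i.d., have mean zero, are $\sigma$-sub-Gaussian, i.e. $\mathbb{E}\exp(z a_{ij})\le \exp(\sigma^2z^2/2)$ for all $z\in\mathbb{R}$, and satisfy $\sigma^2\le\kappa\,\mathrm{Var}(a_{ij})$ (so for $\kappa=1$ the parameter $\sigma^2$ is the variance of the entries, and $C_0,C_1$ are absolute constants). Let $y_1,\dots,y_n\in\{-1,+1\}$ be arbitrary (random) labels, and let $$F(x)=\frac1n\sum_{i=1}^n\log\bigl(1+\exp(-2y_i\,a_i^{\top}x)\bigr)+\frac{\gamma}{2}\|x\|_2^2,\qquad x\in\mathbb{R}^d,$$ be the objective of $\ell_2$-regularized sparse logistic regression. Write $\|v\|_0$ for the number of nonzero coordinates of $v$, $P_S$ for the coordinate projection onto $S\subseteq\{1,\dots,d\}$, and $D=\{x\in\mathbb{R}^d:\|x\|_0\le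 3k+K,\ \|x\|_2\le\omega\}$. Suppose $$n>8C_1(3k+K)\log\!\left(\frac{\mathrm{e}\,d}{3k+K}\right)$$ (the right-hand side being read as $0$ if $3k+K=0$). Then, with probability at least $$1-\exp\!\left(1-\frac{C_0}{\sigma^2\omega^2}\right)-2\exp\!\left(-\frac{n}{8C_1}\right),$$ the restricted condition number $c'$ of $F$ is at most $8.16$, that is, there are $\alpha>0$ and $L'\ge0$ with $L'/\alpha\le 8.16$ such that - (restricted strong convexity at level $k+K$) $F(x')-F(x)-\langle\nabla F(x),x'-x\rangle\ge\frac{\alpha}{2}\|x'-x\|_2^2$ for all $x,x'\in D$ with $\|x-x'\|_0\le k+K$; - (restricted smoothness at level $2k+K$) $\|P_S(\nabla F(x')-\nabla F(x))\|_2\le L'\|x'-x\|_2$ for all $x,x'\in D$ and every $S$ with $|S|\le 2k+K$ and $\mathrm{supp}(x-x')\subseteq S$. -/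

import Mathlib

open MeasureTheory ProbabilityTheory

noncomputable section

namespace SparseLogistic

/-- The support of a vector `v ∈ ℝᵈ`: the set of coordinates at which it is nonzero. -/
def supp {d : ℕ} (v : EuclideanSpace ℝ (Fin d)) : Finset (Fin d) :=
  Finset.univ.filter (fun j => v j ≠ 0)

/-- `‖v‖₀`, the number of nonzero coordinates of `v`. -/
def zeroNorm {d : ℕ} (v : EuclideanSpace ℝ (Fin d)) : ℕ := (supp v).card

/-- The coordinate projection which keeps the coordinates in `S` and sets the others to zero. -/
def proj {d : ℕ} (S : Finset (Fin d)) (v : EuclideanSpace ℝ (Fin d)) :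
    EuclideanSpace ℝ (Fin d) :=
  WithLp.toLp 2 (fun j => if j ∈ S then v j else 0)

/-- The `s`-sparse vectors in the closed Euclidean ball of radius `ω` around the origin. -/
def sparseBall (d s : ℕ) (ω : ℝ) : Set (EuclideanSpace ℝ (Fin d)) :=
  {x | zeroNorm x ≤ s ∧ ‖x‖ ≤ ω}

/-- Restricted strong convexity of `f` at sparsity level `r` with parameter `α`, on the set `D`:
`f x' - f x - ⟨∇f x, x' - x⟩ ≥ (α / 2) ‖x' - x‖²` for `x, x' ∈ D` with `‖x - x'‖₀ ≤ r`. -/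
def RestrictedStrongConvexity {d : ℕ} (f : EuclideanSpace ℝ (Fin d) → ℝ)
    (D : Set (EuclideanSpace ℝ (Fin d))) (r : ℕ) (α : ℝ) : Prop :=
  Differentiable ℝ f ∧ 0 < α ∧
    ∀ x ∈ D, ∀ x' ∈ D, zeroNorm (x - x') ≤ r →
      α / 2 * ‖x' - x‖ ^ 2 ≤ f x' - f x - inner ℝ (gradient f x) (x' - x)

/-- Restricted smoothness of `f` at sparsity level `r` with parameter `L`, on the set `D`:
the change of the gradient between `x, x' ∈ D`, seen on any set `S` of at most `r` coordinates
that carries `x - x'`, is at most `L ‖x' - x‖`. -/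
def RestrictedSmoothness {d : ℕ} (f : EuclideanSpace ℝ (Fin d) → ℝ)
    (D : Set (EuclideanSpace ℝ (Fin d))) (r : ℕ) (L : ℝ) : Prop :=
  Differentiable ℝ f ∧ 0 ≤ L ∧
    ∀ x ∈ D, ∀ x' ∈ D, ∀ S : Finset (Fin d), S.card ≤ r → supp (x - x') ⊆ S →
      ‖proj S (gradient f x' - gradient f x)‖ ≤ L * ‖x' - x‖

/-- The restricted condition number `L / α` of `f` on `D`, with smoothness taken at sparsity level
`rL` and strong convexity at level `rα`, is at most `c`: there are a smoothness parameter `L` and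
a (positive) strong convexity parameter `α` with `L / α ≤ c`. -/
def RestrictedConditionNumberLE {d : ℕ} (f : EuclideanSpace ℝ (Fin d) → ℝ)
    (D : Set (EuclideanSpace ℝ (Fin d))) (rL rα : ℕ) (c : ℝ) : Prop :=
  ∃ L α : ℝ, RestrictedSmoothness f D rL L ∧ RestrictedStrongConvexity f D rα α ∧ L / α ≤ c

/-- The `ℓ₂`-regularized logistic loss
`F(x) = (1/n) ∑ᵢ log (1 + exp (-2 yᵢ aᵢᵀ x)) + (γ/2) ‖x‖²`, with `aᵢ` the `i`-th row of `A`. -/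
def logisticLoss {n d : ℕ} (A : Matrix (Fin n) (Fin d) ℝ) (y : Fin n → ℝ) (γ : ℝ)
    (x : EuclideanSpace ℝ (Fin d)) : ℝ :=
  (1 / (n : ℝ)) * ∑ i, Real.log (1 + Real.exp (-2 * y i * ∑ j, A i j * x j)) +
    γ / 2 * ‖x‖ ^ 2

/-- The entries of the random matrix `A` are i.i.d., centered and `σ`-sub-Gaussian:
`E exp (z aᵢⱼ) ≤ exp (σ² z² / 2)` for all real `z`. -/
structure IsSubGaussianDesign {Ω : Type*} [MeasurableSpace Ω] (μ : Measure Ω) {n d : ℕ}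
    (A : Ω → Matrix (Fin n) (Fin d) ℝ) (σ : NNReal) : Prop where
  measurable : ∀ i j, Measurable (fun w => A w i j)
  indep : iIndepFun (fun (p : Fin n × Fin d) (w : Ω) => A w p.1 p.2) μ
  identDistrib : ∀ p q : Fin n × Fin d,
    IdentDistrib (fun w => A w p.1 p.2) (fun w => A w q.1 q.2) μ μ
  centered : ∀ i j, ∫ w, A w i j ∂μ = 0
  subGaussian : ∀ i j, HasSubgaussianMGF (fun w => A w i j) (σ ^ 2) μ

end SparseLogistic

end

/-! Write `s = 3k + K`, `V` for the variance of the entries and `ℓ` for the logistic loss of a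
margin. The curvature `ℓ''` is at most `1` everywhere and at least `1/2` on margins of size at most
`1/2`, so `F` inherits the restricted conditioning of the quadratic form `∑ ⟨aᵢ, u⟩²`.

The probabilistic input is `TruncatedRestrictedIsometry`: uniformly over `s`-sparse `u`, the form is
at most `1.36 n V ‖u‖²`, and it is still at least `0.52 n V ‖u‖²` after each square is cut off at `B
‖u‖²`, with `B = 960 κ² V`. For one `u` this is a Chernoff bound, resting on a square-exponential
moment of sub-Gaussian variables; a net of at most `exp (102 s log (e d / s))` points and a union
bound make it uniform.

Smoothness uses the upper bound alone. For strong convexity, a point `x` of `D` may depend on `A`,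
so individual margins can be large. But the upper bound gives `∑ ⟨aᵢ, x⟩² ≤ 1.36 n V ω²`, so few
rows have margin above `1/2`, and the cut-off limits what each such row can remove from the lower
bound. The total loss is negligible once `B ω² ≤ 1/1000`. The resulting constants `1.36 V + γ` and
`V / 4 + γ` have quotient below `8.16`.

The good event depends on `A` only, so the labels may be arbitrary. The term `exp (1 - C₀ / (σ²
ω²))` pays for no random event: either it makes the claimed probability nonpositive, or `σ² ω²` is
small enough to force `B ω² ≤ 1/1000`. -/

namespace SparseLogistic

/-! ### Square-exponential moments of sub-Gaussian variables; independence of rows -/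

theorem lintegral_exp_mul_sub_sq {c : ℝ} (hc : 0 < c) (x : ℝ) :
    ∫⁻ g : ℝ, ENNReal.ofReal (Real.exp (g * x - c * g ^ 2)) =
      ENNReal.ofReal (√(Real.pi / c)) * ENNReal.ofReal (Real.exp (x ^ 2 / (4 * c))) := by
  have h1 : ∀ g : ℝ, g * x - c * g ^ 2 = x ^ 2 / (4 * c) + -c * (g - x / (2 * c)) ^ 2 := by
    intro g; field_simp; ring
  have h2 : Integrable (fun g : ℝ => Real.exp (-c * (g - x / (2 * c)) ^ 2)) :=
    (integrable_exp_neg_mul_sq hc).comp_sub_right (x / (2 * c))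
  simp_rw [h1, Real.exp_add]
  rw [← ofReal_integral_eq_lintegral_ofReal (h2.const_mul _)
    (Filter.Eventually.of_forall fun g => by positivity), integral_const_mul,
    integral_sub_right_eq_self (fun g : ℝ => Real.exp (-c * g ^ 2)), integral_gaussian,
    mul_comm, ENNReal.ofReal_mul (by positivity)]

/-- Gaussian linearization: `exp (x² / (4c))` is, up to the factor `√(π / c)`, the integral over `g`
of `exp (g x - c g²)`. After swapping integrals, the moment generating function bound leaves a
Gaussian integral and the constant `√2 ≤ 3/2`. -/
theorem lintegral_exp_sq_le {Ω : Type*} [MeasurableSpace Ω] {μ : Measure Ω}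
    [IsProbabilityMeasure μ] {X : Ω → ℝ} {c : NNReal} (hX : Measurable X) (hc : 0 < c)
    (h : HasSubgaussianMGF X c μ) :
    ∫⁻ w, ENNReal.ofReal (Real.exp (X w ^ 2 / (4 * c))) ∂μ ≤ ENNReal.ofReal (3 / 2) := by
  have hc' : (0 : ℝ) < c := hc
  have hpos : 0 < √(Real.pi / c) := by have := Real.pi_pos; positivity
  have key : ENNReal.ofReal (√(Real.pi / c)) *
      ∫⁻ w, ENNReal.ofReal (Real.exp (X w ^ 2 / (4 * c))) ∂μ ≤
      ENNReal.ofReal (√(Real.pi / c)) * ENNReal.ofReal (3 / 2) := by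
    rw [← lintegral_const_mul _ (by fun_prop)]
    simp_rw [← lintegral_exp_mul_sub_sq hc']
    rw [lintegral_lintegral_swap (by fun_prop)]
    calc ∫⁻ g : ℝ, ∫⁻ w, ENNReal.ofReal (Real.exp (g * X w - c * g ^ 2)) ∂μ
        ≤ ∫⁻ g : ℝ, ENNReal.ofReal (Real.exp (-(c / 2) * g ^ 2)) := by
          refine lintegral_mono fun g => ?_
          have hi := (h.integrable_exp_mul g).mul_const (Real.exp (-(c * g ^ 2)))
          simp_rw [sub_eq_add_neg, Real.exp_add]
          rw [← ofReal_integral_eq_lintegral_ofReal hi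
            (Filter.Eventually.of_forall fun w => by positivity), integral_mul_const]
          apply ENNReal.ofReal_le_ofReal
          calc (∫ w, Real.exp (g * X w) ∂μ) * Real.exp (-(c * g ^ 2))
              ≤ Real.exp (c * g ^ 2 / 2) * Real.exp (-(c * g ^ 2)) := by
                gcongr; exact h.mgf_le g
            _ = Real.exp (-(c / 2) * g ^ 2) := by rw [← Real.exp_add]; congr 1; ring
      _ = ENNReal.ofReal (√(Real.pi / (c / 2))) := by
          rw [← ofReal_integral_eq_lintegral_ofReal (integrable_exp_neg_mul_sq (by positivity))
            (Filter.Eventually.of_forall fun w => by positivity), integral_gaussian]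
      _ ≤ _ := by
          rw [← ENNReal.ofReal_mul hpos.le]
          apply ENNReal.ofReal_le_ofReal
          apply Real.sqrt_le_iff.2 ⟨by positivity, ?_⟩
          rw [mul_pow, Real.sq_sqrt (by have := Real.pi_pos; positivity)]
          have : Real.pi / (c / 2 : ℝ) = Real.pi / c * 2 := by field_simp
          rw [this]
          gcongr
          norm_num
  exact (ENNReal.mul_le_mul_iff_right (by simpa using hpos) ENNReal.ofReal_ne_top).1 key

theorem integrable_exp_sq {Ω : Type*} [MeasurableSpace Ω] {μ : Measure Ω}
    [IsProbabilityMeasure μ] {X : Ω → ℝ} {c : NNReal} (hX : Measurable X) (hc : 0 < c)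
    (h : HasSubgaussianMGF X c μ) :
    Integrable (fun w => Real.exp (X w ^ 2 / (4 * c))) μ := by
  refine (lintegral_ofReal_ne_top_iff_integrable (by fun_prop)
    (Filter.Eventually.of_forall fun w => by positivity)).1 ?_
  exact ((lintegral_exp_sq_le hX hc h).trans_lt ENNReal.ofReal_lt_top).ne

theorem integral_exp_sq_le {Ω : Type*} [MeasurableSpace Ω] {μ : Measure Ω}
    [IsProbabilityMeasure μ] {X : Ω → ℝ} {c : NNReal} (hX : Measurable X) (hc : 0 < c)
    (h : HasSubgaussianMGF X c μ) :
    ∫ w, Real.exp (X w ^ 2 / (4 * c)) ∂μ ≤ 3 / 2 := by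
  rw [← ENNReal.ofReal_le_ofReal_iff (by norm_num),
    ofReal_integral_eq_lintegral_ofReal (integrable_exp_sq hX hc h)
      (Filter.Eventually.of_forall fun w => by positivity)]
  exact lintegral_exp_sq_le hX hc h

/-- Rows of a matrix with independent entries are independent. -/
theorem iIndepFun_rows {Ω ι κ : Type*} [MeasurableSpace Ω] {μ : Measure Ω}
    {X : ι → κ → Ω → ℝ} (hX : ∀ i j, Measurable (X i j))
    (h : iIndepFun (fun (p : ι × κ) w => X p.1 p.2 w) μ) :
    iIndepFun (fun i w j => X i j w) μ := by
  have := h.isProbabilityMeasure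
  have hp : ∀ i j, IsProbabilityMeasure (μ.map (X i j)) := fun i j =>
    Measure.isProbabilityMeasure_map (hX i j).aemeasurable
  have h' : iIndepFun (fun (p : (_ : ι) × κ) w => X p.1 p.2 w) μ :=
    h.precomp (g := fun p : (_ : ι) × κ => (p.1, p.2)) (by rintro ⟨a, b⟩ ⟨c, d⟩ hh; simp_all)
  have hrow : ∀ i, iIndepFun (X i) μ := fun i =>
    h.precomp (g := fun j => (i, j)) (Prod.mk_right_injective i)
  rw [iIndepFun_iff_map_fun_eq_infinitePi_map (by fun_prop)]
  -- The joint law of the entries is a product measure; currying it gives the product of the row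
  -- laws, which is independence of the rows. The sigma type is the index shape that currying
  -- expects.
  have hmap : μ.map (fun w i j => X i j w) =
      (μ.map (fun w (p : (_ : ι) × κ) => X p.1 p.2 w)).map
        (MeasurableEquiv.piCurry (fun (_ : ι) (_ : κ) => ℝ)) := by
    rw [Measure.map_map (by fun_prop) (by fun_prop)]
    rfl
  rw [hmap, h'.map_fun_eq_infinitePi_map (by fun_prop),
    Measure.infinitePi_map_piCurry (fun i j => μ.map (X i j))]
  congr 1
  ext1 i
  rw [(hrow i).map_fun_eq_infinitePi_map (hX i)]

end SparseLogistic

/-! ### Moment bounds and the Chernoff inequality -/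

namespace SparseLogistic

section Moments

variable {Ω : Type*} [MeasurableSpace Ω] {μ : Measure Ω} [IsProbabilityMeasure μ]
  {X : Ω → ℝ} {c : NNReal}

theorem sq_le_two_mul_exp {t : ℝ} (ht : 0 ≤ t) : t ^ 2 ≤ 2 * Real.exp t := by
  have := Real.quadratic_le_exp_of_nonneg ht
  nlinarith

theorem pow_four_le_exp {v : ℝ} (hv : 0 < v) (x : ℝ) :
    x ^ 4 ≤ 32 * v ^ 2 * Real.exp (x ^ 2 / (4 * v)) := by
  have h := sq_le_two_mul_exp (t := x ^ 2 / (4 * v)) (by positivity)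
  have e : x ^ 4 = 16 * v ^ 2 * (x ^ 2 / (4 * v)) ^ 2 := by field_simp; norm_num
  rw [e]
  nlinarith [sq_nonneg v]

theorem sq_le_exp {v : ℝ} (hv : 0 < v) (x : ℝ) :
    x ^ 2 ≤ 4 * v * Real.exp (x ^ 2 / (4 * v)) := by
  have h := Real.add_one_le_exp (x ^ 2 / (4 * v))
  have e : x ^ 2 = 4 * v * (x ^ 2 / (4 * v)) := by field_simp
  nlinarith

theorem integrable_pow_four (hX : Measurable X) (hc : 0 < c) (h : HasSubgaussianMGF X c μ) :
    Integrable (fun w => X w ^ 4) μ := by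
  refine ((integrable_exp_sq hX hc h).const_mul (32 * (c : ℝ) ^ 2)).mono' (by fun_prop) ?_
  refine Filter.Eventually.of_forall fun w => ?_
  rw [Real.norm_of_nonneg (by positivity)]
  exact pow_four_le_exp hc _

theorem integrable_sq (hX : Measurable X) (hc : 0 < c) (h : HasSubgaussianMGF X c μ) :
    Integrable (fun w => X w ^ 2) μ := by
  refine ((integrable_exp_sq hX hc h).const_mul (4 * (c : ℝ))).mono' (by fun_prop) ?_
  refine Filter.Eventually.of_forall fun w => ?_
  rw [Real.norm_of_nonneg (by positivity)]
  exact sq_le_exp hc _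

theorem integral_pow_four_le (hX : Measurable X) (hc : 0 < c) (h : HasSubgaussianMGF X c μ) :
    ∫ w, X w ^ 4 ∂μ ≤ 48 * (c : ℝ) ^ 2 := by
  calc ∫ w, X w ^ 4 ∂μ ≤ ∫ w, 32 * (c : ℝ) ^ 2 * Real.exp (X w ^ 2 / (4 * c)) ∂μ :=
        integral_mono (integrable_pow_four hX hc h) ((integrable_exp_sq hX hc h).const_mul _)
          fun w => pow_four_le_exp hc _
    _ ≤ _ := by
        rw [integral_const_mul]
        nlinarith [integral_exp_sq_le hX hc h, sq_nonneg (c : ℝ)]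

theorem integral_sq_le (hX : Measurable X) (hc : 0 < c) (h : HasSubgaussianMGF X c μ) :
    ∫ w, X w ^ 2 ∂μ ≤ 6 * (c : ℝ) := by
  have hc' : (0 : ℝ) < c := hc
  calc ∫ w, X w ^ 2 ∂μ ≤ ∫ w, 4 * (c : ℝ) * Real.exp (X w ^ 2 / (4 * c)) ∂μ :=
        integral_mono (integrable_sq hX hc h) ((integrable_exp_sq hX hc h).const_mul _)
          fun w => sq_le_exp hc _
    _ ≤ _ := by
        rw [integral_const_mul]
        nlinarith [integral_exp_sq_le hX hc h]

/-- Multiply `exp t * (1 - t) ≤ 1` by `1 + t`. -/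
theorem exp_le_one_add_add_sq_mul_exp {t : ℝ} (ht : 0 ≤ t) :
    Real.exp t ≤ 1 + t + t ^ 2 * Real.exp t := by
  have h := Real.add_one_le_exp (-t)
  have e : Real.exp t * Real.exp (-t) = 1 := by rw [← Real.exp_add]; simp
  have hp := Real.exp_pos t
  have h1 : Real.exp t * (1 - t) ≤ 1 := by nlinarith
  have h2 : Real.exp t * (1 - t) * (1 + t) ≤ 1 * (1 + t) := by gcongr
  nlinarith

theorem exp_neg_le_quadratic {t : ℝ} (ht : 0 ≤ t) :
    Real.exp (-t) ≤ 1 - t + t ^ 2 / 2 := by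
  have h := Real.quadratic_le_exp_of_nonneg ht
  have e : Real.exp t * Real.exp (-t) = 1 := by rw [← Real.exp_add]; simp
  have hp := Real.exp_pos (-t)
  have h1 : (1 + t + t ^ 2 / 2) * Real.exp (-t) ≤ 1 := by nlinarith
  have h2 : (1 + t + t ^ 2 / 2) * (1 - t + t ^ 2 / 2) ≥ 1 := by nlinarith [pow_nonneg ht 4]
  have h3 : 0 < 1 + t + t ^ 2 / 2 := by positivity
  nlinarith

theorem integrable_exp_mul_sq (hX : Measurable X) (hc : 0 < c) (h : HasSubgaussianMGF X c μ)
    {l : ℝ} (hl : l ≤ 1 / (4 * c)) :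
    Integrable (fun w => Real.exp (l * X w ^ 2)) μ := by
  refine (integrable_exp_sq hX hc h).mono' (by fun_prop) ?_
  refine Filter.Eventually.of_forall fun w => ?_
  rw [Real.norm_of_nonneg (by positivity), div_eq_mul_one_div, mul_comm]
  gcongr

theorem integral_exp_mul_sq_le (hX : Measurable X) (hc : 0 < c) (h : HasSubgaussianMGF X c μ)
    {l : ℝ} (hl0 : 0 ≤ l) (hl : l ≤ 1 / (8 * c)) :
    ∫ w, Real.exp (l * X w ^ 2) ∂μ ≤
      1 + l * ∫ w, X w ^ 2 ∂μ + 192 * l ^ 2 * (c : ℝ) ^ 2 := by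
  have hc' : (0 : ℝ) < c := hc
  have hl4 : l ≤ 1 / (4 * c) := hl.trans (by gcongr; norm_num)
  have hpt : ∀ x : ℝ, Real.exp (l * x ^ 2) ≤
      1 + l * x ^ 2 + 128 * l ^ 2 * (c : ℝ) ^ 2 * Real.exp (x ^ 2 / (4 * c)) := by
    intro x
    have h1 := exp_le_one_add_add_sq_mul_exp (t := l * x ^ 2) (by positivity)
    have h2 : Real.exp (l * x ^ 2) ≤ Real.exp (x ^ 2 / (4 * (2 * c))) := by
      rw [div_eq_mul_one_div, mul_comm, ← mul_assoc]
      norm_num at hl ⊢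
      gcongr
    -- Half of the available exponent `x² / (4c)` absorbs the fourth power and the other half
    -- absorbs `exp (l x²)`; this is why `l ≤ 1 / (8c)` is required.
    have h3 := pow_four_le_exp (v := 2 * c) (by positivity) x
    have h4 : Real.exp (x ^ 2 / (4 * c)) =
        Real.exp (x ^ 2 / (4 * (2 * c))) * Real.exp (x ^ 2 / (4 * (2 * c))) := by
      rw [← Real.exp_add]; congr 1; field_simp; norm_num
    have h5 : (l * x ^ 2) ^ 2 * Real.exp (l * x ^ 2) ≤
        l ^ 2 * ((32 * (2 * c : ℝ) ^ 2 * Real.exp (x ^ 2 / (4 * (2 * c)))) *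
          Real.exp (x ^ 2 / (4 * (2 * c)))) := by
      have : (l * x ^ 2) ^ 2 = l ^ 2 * x ^ 4 := by ring
      rw [this, mul_assoc]
      gcongr
    rw [h4]
    nlinarith
  have hi1 := (integrable_sq hX hc h).const_mul l
  have hi3 : Integrable (fun w => 1 + l * X w ^ 2) μ := (integrable_const _).add hi1
  have hi2 := (integrable_exp_sq hX hc h).const_mul (128 * l ^ 2 * (c : ℝ) ^ 2)
  calc ∫ w, Real.exp (l * X w ^ 2) ∂μ
      ≤ ∫ w, (1 + l * X w ^ 2 + 128 * l ^ 2 * (c : ℝ) ^ 2 * Real.exp (X w ^ 2 / (4 * c))) ∂μ :=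
        integral_mono (integrable_exp_mul_sq hX hc h hl4)
          (hi3.add hi2) fun w => hpt _
    _ = 1 + l * ∫ w, X w ^ 2 ∂μ +
        128 * l ^ 2 * (c : ℝ) ^ 2 * ∫ w, Real.exp (X w ^ 2 / (4 * c)) ∂μ := by
        rw [integral_add hi3 hi2, integral_add (integrable_const _) hi1,
          integral_const_mul, integral_const_mul]
        simp
    _ ≤ _ := by
        have := integral_exp_sq_le hX hc h
        have h0 : 0 ≤ l ^ 2 * (c : ℝ) ^ 2 := by positivity
        nlinarith

/-- Truncating a square at `B` costs at most its fourth power over `B`, so the loss in expectation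
is controlled by the fourth moment. -/
theorem sub_sq_div_le_min {a B : ℝ} (hB : 0 < B) : a - a ^ 2 / B ≤ min a B := by
  have h0 : 0 ≤ a ^ 2 / B := by positivity
  refine le_min (by linarith) ?_
  have : a ^ 2 / B * B = a ^ 2 := by field_simp
  nlinarith [sq_nonneg (a - B)]

theorem integral_exp_neg_mul_min_le (hX : Measurable X) (hc : 0 < c)
    (h : HasSubgaussianMGF X c μ) {l B : ℝ} (hl0 : 0 ≤ l) (hB : 0 < B) :
    ∫ w, Real.exp (-(l * min (X w ^ 2) B)) ∂μ ≤
      1 - l * (∫ w, X w ^ 2 ∂μ - 48 * (c : ℝ) ^ 2 / B) + 24 * l ^ 2 * (c : ℝ) ^ 2 := by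
  have hc' : (0 : ℝ) < c := hc
  have hpt : ∀ x : ℝ, Real.exp (-(l * min (x ^ 2) B)) ≤
      1 - l * x ^ 2 + (l / B + l ^ 2 / 2) * x ^ 4 := by
    intro x
    have hm : 0 ≤ min (x ^ 2) B := le_min (by positivity) hB.le
    have h1 := exp_neg_le_quadratic (t := l * min (x ^ 2) B) (by positivity)
    have h2 := mul_le_mul_of_nonneg_left (sub_sq_div_le_min (a := x ^ 2) hB) hl0
    have h3 : (min (x ^ 2) B) ^ 2 ≤ (x ^ 2) ^ 2 := by gcongr; exact min_le_left _ _
    have h4 := mul_le_mul_of_nonneg_left h3 (sq_nonneg l)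
    have h5 : l * (x ^ 2 - (x ^ 2) ^ 2 / B) = l * x ^ 2 - l / B * x ^ 4 := by ring
    nlinarith
  have hi1 := (integrable_sq hX hc h).const_mul l
  have hi3 : Integrable (fun w => 1 - l * X w ^ 2) μ := (integrable_const _).sub hi1
  have hi2 := (integrable_pow_four hX hc h).const_mul (l / B + l ^ 2 / 2)
  calc ∫ w, Real.exp (-(l * min (X w ^ 2) B)) ∂μ
      ≤ ∫ w, (1 - l * X w ^ 2 + (l / B + l ^ 2 / 2) * X w ^ 4) ∂μ := by
        refine integral_mono_of_nonneg (Filter.Eventually.of_forall fun w => by positivity)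
          (hi3.add hi2) (Filter.Eventually.of_forall fun w => hpt _)
    _ = 1 - l * ∫ w, X w ^ 2 ∂μ + (l / B + l ^ 2 / 2) * ∫ w, X w ^ 4 ∂μ := by
        rw [integral_add hi3 hi2, integral_sub (integrable_const _) hi1,
          integral_const_mul, integral_const_mul]
        simp
    _ ≤ 1 - l * ∫ w, X w ^ 2 ∂μ + (l / B + l ^ 2 / 2) * (48 * (c : ℝ) ^ 2) := by
        gcongr
        exact integral_pow_four_le hX hc h
    _ = _ := by ring

/-- Chernoff's bound at parameter `1`; the threshold and the exponential parameter are meant to be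
absorbed into `W`. -/
theorem measureReal_sum_nonneg_le {n : ℕ} {W : Fin n → Ω → ℝ} (hW : ∀ i, Measurable (W i))
    (hind : iIndepFun W μ) (hint : ∀ i, Integrable (fun w => Real.exp (W i w)) μ) {r : ℝ}
    (hr : ∀ i, ∫ w, Real.exp (W i w) ∂μ ≤ Real.exp (-r)) :
    μ.real {w | 0 ≤ ∑ i, W i w} ≤ Real.exp (-(r * n)) := by
  have hsum : (fun w => ∑ i, W i w) = ∑ i, W i := by ext; simp
  have hint' : Integrable (fun w => Real.exp (1 * (∑ i, W i) w)) μ :=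
    hind.integrable_exp_mul_sum hW (fun i _ => by simpa using hint i)
  have h := measure_ge_le_exp_mul_mgf (μ := μ) (X := ∑ i, W i) (t := 1) 0 zero_le_one hint'
  rw [hind.mgf_sum hW] at h
  simp only [mul_zero, Real.exp_zero, one_mul, Finset.sum_apply] at h
  refine h.trans ?_
  calc ∏ i, mgf (W i) μ 1 ≤ ∏ _i : Fin n, Real.exp (-r) :=
        Finset.prod_le_prod (fun i _ => mgf_nonneg) fun i _ => by simpa [mgf] using hr i
    _ = Real.exp (-(r * n)) := by
        rw [Finset.prod_const, ← Real.exp_nat_mul]; simp; ring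

end Moments

end SparseLogistic

/-! ### Tail bounds for the quadratic form at a fixed vector -/

namespace SparseLogistic

/-- The vector of inner products of the rows of `A` with `x`. -/
def rowDot {n d : ℕ} (A : Matrix (Fin n) (Fin d) ℝ) (x : EuclideanSpace ℝ (Fin d)) (i : Fin n) :
    ℝ :=
  ∑ j, A i j * x j

namespace IsSubGaussianDesign

variable {Ω : Type*} [MeasurableSpace Ω] {μ : Measure Ω} {n d : ℕ}
  {A : Ω → Matrix (Fin n) (Fin d) ℝ} {σ : NNReal}

theorem measurable_rowDot (h : IsSubGaussianDesign μ A σ) (u : EuclideanSpace ℝ (Fin d))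
    (i : Fin n) : Measurable (fun w => rowDot (A w) u i) := by
  have := h.measurable
  unfold rowDot
  fun_prop

theorem iIndepFun_comp_rowDot (h : IsSubGaussianDesign μ A σ) (u : EuclideanSpace ℝ (Fin d))
    {g : ℝ → ℝ} (hg : Measurable g) : iIndepFun (fun i w => g (rowDot (A w) u i)) μ := by
  have h1 := iIndepFun_rows (X := fun i j w => A w i j) h.measurable h.indep
  exact h1.comp (fun _ (a : Fin d → ℝ) => g (∑ j, a j * u j)) (fun _ => by fun_prop)

theorem iIndepFun_row (h : IsSubGaussianDesign μ A σ) (u : EuclideanSpace ℝ (Fin d))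
    (i : Fin n) : iIndepFun (fun j w => u j * A w i j) μ :=
  (h.indep.precomp (g := fun j => (i, j)) (Prod.mk_right_injective i)).comp
    (fun j a => u j * a) (fun _ => by fun_prop)

theorem hasSubgaussianMGF_rowDot (h : IsSubGaussianDesign μ A σ) {u : EuclideanSpace ℝ (Fin d)}
    (hu : ‖u‖ ≤ 1) (i : Fin n) : HasSubgaussianMGF (fun w => rowDot (A w) u i) (σ ^ 2) μ := by
  have h1 := HasSubgaussianMGF.sum_of_iIndepFun (h.iIndepFun_row u i) (s := Finset.univ)
    (c := fun j => Real.toNNReal (u j ^ 2) * σ ^ 2) fun j _ => by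
      rw [Real.toNNReal_of_nonneg (sq_nonneg (u j))]
      exact (h.subGaussian i j).const_mul (u j)
  have h2 : (fun w => ∑ j, u j * A w i j) = fun w => rowDot (A w) u i := by
    ext w; simp [rowDot, mul_comm]
  rw [h2] at h1
  -- The sum has parameter `σ² ‖u‖²`, which is relaxed to `σ²`.
  refine ⟨h1.integrable_exp_mul, fun t => (h1.mgf_le t).trans ?_⟩
  apply Real.exp_le_exp.2
  have h3 : ∑ j, u j ^ 2 ≤ 1 := by
    rw [← EuclideanSpace.real_norm_sq_eq]; nlinarith [norm_nonneg u]
  have h4 : ((∑ j, Real.toNNReal (u j ^ 2) * σ ^ 2 : NNReal) : ℝ) ≤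
      ((σ ^ 2 : NNReal) : ℝ) := by
    rw [← Finset.sum_mul, NNReal.coe_mul, NNReal.coe_sum]
    refine mul_le_of_le_one_left (NNReal.coe_nonneg _) ?_
    simpa [Real.coe_toNNReal _ (sq_nonneg _)] using h3
  have h5 := mul_le_mul_of_nonneg_right h4 (sq_nonneg t)
  linarith

theorem integral_rowDot_sq (h : IsSubGaussianDesign μ A σ) {V : ℝ}
    (hV : ∀ i j, variance (fun w => A w i j) μ = V) (u : EuclideanSpace ℝ (Fin d)) (i : Fin n) :
    ∫ w, rowDot (A w) u i ^ 2 ∂μ = V * ‖u‖ ^ 2 := by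
  have h2 : (∑ j, fun w => u j * A w i j) = fun w => rowDot (A w) u i := by
    ext w; simp [rowDot, mul_comm]
  have hm : ∀ j, MemLp (fun w => u j * A w i j) 2 μ := fun j =>
    ((h.subGaussian i j).const_mul (u j)).memLp 2
  have h3 := IndepFun.variance_sum (μ := μ) (s := Finset.univ) (X := fun j w => u j * A w i j)
    (fun j _ => hm j) (fun a _ b _ hab => (h.iIndepFun_row u i).indepFun hab)
  have h4 : ∫ w, rowDot (A w) u i ∂μ = 0 := by
    unfold rowDot
    rw [integral_finsetSum _ fun j _ => (h.subGaussian i j).integrable.mul_const _]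
    simp [integral_mul_const, h.centered]
  rw [h2, variance_of_integral_eq_zero (h.measurable_rowDot u i).aemeasurable h4] at h3
  rw [h3, EuclideanSpace.real_norm_sq_eq, Finset.mul_sum]
  refine Finset.sum_congr rfl fun j _ => ?_
  rw [variance_const_mul, hV, mul_comm]

variable [IsProbabilityMeasure μ] {V κ : ℝ} {u : EuclideanSpace ℝ (Fin d)}

theorem upper_tail (h : IsSubGaussianDesign μ A σ) (hσ : 0 < σ)
    (hV : ∀ i j, variance (fun w => A w i j) μ = V) (hκ : 1 ≤ κ) (hσV : (σ : ℝ) ^ 2 ≤ κ * V)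
    (hu : ‖u‖ ≤ 1) :
    μ.real {w | n * (V * (‖u‖ ^ 2 + 1 / 10)) ≤ ∑ i, rowDot (A w) u i ^ 2} ≤
      Real.exp (-(1 / (10 ^ 5 * κ ^ 2) * n)) := by
  have hσ' : (0 : ℝ) < σ := hσ
  -- The linear gain `l V / 10 ≥ 2.5e-5 / κ²` beats the second-order error `192 l² σ⁴ = 1.2e-5 / κ²`
  -- by more than the rate `1e-5 / κ²`.
  obtain ⟨l, hl⟩ : ∃ l : ℝ, l = 1 / (4000 * κ * σ ^ 2) := ⟨_, rfl⟩
  have hl0 : 0 < l := by rw [hl]; positivity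
  have hl8 : l ≤ 1 / (8 * ((σ ^ 2 : NNReal) : ℝ)) := by
    rw [hl]; push_cast; gcongr; linarith
  have hm := h.measurable_rowDot u
  have hlV : 1 / (4000 * κ ^ 2) ≤ l * V := by
    rw [hl, div_mul_eq_mul_div, div_le_div_iff₀ (by positivity) (by positivity)]
    nlinarith [mul_le_mul_of_nonneg_left hσV (show 0 ≤ κ by linarith)]
  have hlσ : l ^ 2 * ((σ ^ 2 : NNReal) : ℝ) ^ 2 = 1 / (16000000 * κ ^ 2) := by
    rw [hl]; push_cast; field_simp; norm_num
  have key := measureReal_sum_nonneg_le (μ := μ)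
    (W := fun i w => l * rowDot (A w) u i ^ 2 - l * (V * (‖u‖ ^ 2 + 1 / 10)))
    (r := 1 / (10 ^ 5 * κ ^ 2)) (fun i => by have := hm i; fun_prop)
    (h.iIndepFun_comp_rowDot u (g := fun t => l * t ^ 2 - l * (V * (‖u‖ ^ 2 + 1 / 10)))
      (by fun_prop)) ?_ ?_
  · refine le_trans (measureReal_mono fun w hw => ?_) key
    simp only [Set.mem_ofPred_eq, Finset.sum_sub_distrib, Finset.sum_const, Finset.card_univ,
      Fintype.card_fin, nsmul_eq_mul, ← Finset.mul_sum] at hw ⊢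
    nlinarith [mul_le_mul_of_nonneg_left hw hl0.le]
  · intro i
    simp_rw [sub_eq_add_neg, Real.exp_add]
    refine (integrable_exp_mul_sq (hm i) (by positivity) (h.hasSubgaussianMGF_rowDot hu i)
      (hl8.trans ?_)).mul_const _
    gcongr; norm_num
  · intro i
    simp_rw [sub_eq_add_neg, Real.exp_add]
    rw [integral_mul_const]
    have h1 := integral_exp_mul_sq_le (hm i) (by positivity) (h.hasSubgaussianMGF_rowDot hu i)
      hl0.le hl8
    rw [h.integral_rowDot_sq hV u i, mul_assoc 192, hlσ] at h1
    have h2 := h1.trans (le_trans (le_of_eq (by ring))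
      (Real.add_one_le_exp (l * (V * ‖u‖ ^ 2) + 192 * (1 / (16000000 * κ ^ 2)))))
    refine (mul_le_mul_of_nonneg_right h2 (by positivity)).trans ?_
    rw [← Real.exp_add]
    apply Real.exp_le_exp.2
    have e1 : 1 / (4000 * κ ^ 2) = (1 / 4000) * (1 / κ ^ 2) := by ring
    have e2 : 1 / (16000000 * κ ^ 2) = (1 / 16000000) * (1 / κ ^ 2) := by ring
    have e3 : 1 / (10 ^ 5 * κ ^ 2) = (1 / 10 ^ 5) * (1 / κ ^ 2) := by ring
    have e4 : 0 < 1 / κ ^ 2 := by positivity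
    rw [e1] at hlV
    rw [e2, e3]
    nlinarith

theorem lower_tail (h : IsSubGaussianDesign μ A σ) (hσ : 0 < σ)
    (hV : ∀ i j, variance (fun w => A w i j) μ = V) (hκ : 1 ≤ κ) (hσV : (σ : ℝ) ^ 2 ≤ κ * V)
    (hu : ‖u‖ ≤ 1) :
    μ.real {w | ∑ i, min (rowDot (A w) u i ^ 2) (960 * κ ^ 2 * V) ≤
        n * (V * (‖u‖ ^ 2 - 1 / 10))} ≤
      Real.exp (-(1 / (10 ^ 5 * κ ^ 2) * n)) := by
  have hσ' : (0 : ℝ) < σ := hσ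
  have hV0 : 0 < V := by
    have : 0 < κ * V := lt_of_lt_of_le (by positivity) hσV
    exact pos_of_mul_pos_right this (by linarith)
  obtain ⟨B, hB⟩ : ∃ B : ℝ, B = 960 * κ ^ 2 * V := ⟨_, rfl⟩
  have hB0 : 0 < B := by rw [hB]; positivity
  obtain ⟨l, hl⟩ : ∃ l : ℝ, l = 1 / (4000 * κ * σ ^ 2) := ⟨_, rfl⟩
  have hl0 : 0 < l := by rw [hl]; positivity
  have hm := h.measurable_rowDot u
  have hlV : 1 / (4000 * κ ^ 2) ≤ l * V := by
    rw [hl, div_mul_eq_mul_div, div_le_div_iff₀ (by positivity) (by positivity)]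
    nlinarith [mul_le_mul_of_nonneg_left hσV (show 0 ≤ κ by linarith)]
  have hlσ : l ^ 2 * ((σ ^ 2 : NNReal) : ℝ) ^ 2 = 1 / (16000000 * κ ^ 2) := by
    rw [hl]; push_cast; field_simp; norm_num
  -- The level `B` is chosen so that truncation uses up only half of the allowed deviation `V / 10`.
  have hBσ : 48 * ((σ ^ 2 : NNReal) : ℝ) ^ 2 / B ≤ V / 20 := by
    rw [hB, div_le_div_iff₀ (by positivity) (by positivity)]
    push_cast
    have : ((σ : ℝ) ^ 2) ^ 2 ≤ (κ * V) ^ 2 := by gcongr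
    nlinarith
  rw [← hB]
  have key := measureReal_sum_nonneg_le (μ := μ)
    (W := fun i w => -(l * min (rowDot (A w) u i ^ 2) B) + l * (V * (‖u‖ ^ 2 - 1 / 10)))
    (r := 1 / (10 ^ 5 * κ ^ 2)) (fun i => by have := hm i; fun_prop)
    (h.iIndepFun_comp_rowDot u (g := fun t => -(l * min (t ^ 2) B) + l * (V * (‖u‖ ^ 2 - 1 / 10)))
      (by fun_prop)) ?_ ?_
  · refine le_trans (measureReal_mono fun w hw => ?_) key
    simp only [Set.mem_ofPred_eq, Finset.sum_add_distrib, Finset.sum_const, Finset.card_univ,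
      Fintype.card_fin, nsmul_eq_mul, ← Finset.mul_sum, Finset.sum_neg_distrib] at hw ⊢
    nlinarith [mul_le_mul_of_nonneg_left hw hl0.le]
  · intro i
    simp_rw [Real.exp_add]
    refine Integrable.mul_const ?_ _
    refine Integrable.of_bound (C := 1)
      (Measurable.aestronglyMeasurable (by have := hm i; fun_prop)) ?_
    refine Filter.Eventually.of_forall fun w => ?_
    rw [Real.norm_of_nonneg (by positivity), Real.exp_le_one_iff, neg_nonpos]
    exact mul_nonneg hl0.le (le_min (by positivity) hB0.le)
  · intro i
    simp_rw [Real.exp_add]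
    rw [integral_mul_const]
    have h1 := integral_exp_neg_mul_min_le (hm i) (by positivity)
      (h.hasSubgaussianMGF_rowDot hu i) hl0.le hB0
    rw [h.integral_rowDot_sq hV u i, mul_assoc 24, hlσ] at h1
    have h2 := h1.trans (le_trans (le_of_eq (by ring))
      (Real.add_one_le_exp (-(l * (V * ‖u‖ ^ 2 - 48 * ((σ ^ 2 : NNReal) : ℝ) ^ 2 / B)) +
        24 * (1 / (16000000 * κ ^ 2)))))
    refine (mul_le_mul_of_nonneg_right h2 (by positivity)).trans ?_
    rw [← Real.exp_add]
    apply Real.exp_le_exp.2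
    have e1 : 1 / (4000 * κ ^ 2) = (1 / 4000) * (1 / κ ^ 2) := by ring
    have e2 : 1 / (16000000 * κ ^ 2) = (1 / 16000000) * (1 / κ ^ 2) := by ring
    have e3 : 1 / (10 ^ 5 * κ ^ 2) = (1 / 10 ^ 5) * (1 / κ ^ 2) := by ring
    have e4 : 0 < 1 / κ ^ 2 := by positivity
    have e5 := mul_le_mul_of_nonneg_left hBσ hl0.le
    rw [e1] at hlV
    rw [e2, e3]
    nlinarith

end IsSubGaussianDesign

end SparseLogistic

/-! ### A net of the sparse unit ball -/

namespace SparseLogistic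

theorem sum_Icc_weight_le {θ : ℝ} (hθ : 0 ≤ θ) (R : ℕ) :
    ∑ m ∈ Finset.Icc (-(R : ℤ)) R, (if m = 0 then 1 else θ) * Real.exp (-(m : ℝ) ^ 2) ≤
      1 + 2 * θ := by
  -- The geometric remainder makes the induction close, through `exp (-m²) ≤ 2⁻ᵐ` for `m ≥ 1`.
  suffices h : ∑ m ∈ Finset.Icc (-(R : ℤ)) R,
      (if m = 0 then 1 else θ) * Real.exp (-(m : ℝ) ^ 2) ≤ 1 + 2 * θ * (1 - (1 / 2) ^ R) by
    have : 0 ≤ θ * (1 / 2 : ℝ) ^ R := by positivity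
    linarith
  induction R with
  | zero => simp
  | succ R ih =>
    have e : Finset.Icc (-((R + 1 : ℕ) : ℤ)) ((R + 1 : ℕ) : ℤ) =
        insert (-((R + 1 : ℕ) : ℤ)) (insert ((R + 1 : ℕ) : ℤ) (Finset.Icc (-(R : ℤ)) R)) := by
      ext m; simp only [Finset.mem_Icc, Finset.mem_insert]; omega
    rw [e, Finset.sum_insert (by simp only [Finset.mem_insert, Finset.mem_Icc]; omega),
      Finset.sum_insert (by simp only [Finset.mem_Icc]; omega)]
    have h1 : Real.exp (-((R + 1 : ℕ) : ℝ) ^ 2) ≤ (1 / 2) ^ (R + 1) := by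
      have h2 : Real.exp (-1) ≤ 1 / 2 := by
        have := Real.exp_one_gt_d9
        rw [Real.exp_neg, one_div]
        exact inv_anti₀ (by norm_num) (by linarith)
      calc Real.exp (-((R + 1 : ℕ) : ℝ) ^ 2) ≤ Real.exp (((R + 1 : ℕ) : ℝ) * (-1)) := by
            apply Real.exp_le_exp.2; push_cast; nlinarith [Nat.cast_nonneg (α := ℝ) R]
        _ = Real.exp (-1) ^ (R + 1) := by rw [Real.exp_nat_mul]
        _ ≤ _ := by gcongr
    rw [if_neg (by omega), if_neg (by omega)]
    push_cast at h1 ⊢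
    rw [neg_sq]
    rw [pow_succ (1 / 2 : ℝ) R] at h1 ⊢
    nlinarith [mul_le_mul_of_nonneg_left h1 hθ]

/-- The integer vectors with at most `s` nonzero coordinates and squared norm at most `100 s`. -/
noncomputable def sparseGrid (d s : ℕ) : Finset (Fin d → ℤ) :=
  (Fintype.piFinset fun _ : Fin d => Finset.Icc (-((100 * s : ℕ) : ℤ)) (100 * s : ℕ)).filter
    fun z => (Finset.univ.filter fun j => z j ≠ 0).card ≤ s ∧ ∑ j, z j ^ 2 ≤ 100 * s

/-- The box in the definition serves finiteness only: `|z j| ≤ (z j)²` for integers, so the norm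
bound implies it. -/
theorem mem_sparseGrid {d s : ℕ} {z : Fin d → ℤ} : z ∈ sparseGrid d s ↔
    (Finset.univ.filter fun j => z j ≠ 0).card ≤ s ∧ ∑ j, z j ^ 2 ≤ 100 * s := by
  simp only [sparseGrid, Finset.mem_filter, Fintype.mem_piFinset, Finset.mem_Icc,
    and_iff_right_iff_imp]
  rintro ⟨-, h⟩ j
  have h1 : z j ^ 2 ≤ ∑ j, z j ^ 2 :=
    Finset.single_le_sum (f := fun j => z j ^ 2) (fun _ _ => sq_nonneg _) (Finset.mem_univ j)
  rw [← abs_le]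
  have h2 : |z j| ≤ z j ^ 2 := by
    rw [← sq_abs, sq]
    rcases (abs_nonneg (z j)).eq_or_lt with h | h
    · simp [← h]
    · exact le_mul_of_one_le_left h.le h
  push_cast
  linarith

/-- Counting by weights. With `θ = s / d`, give an integer `m` the weight `exp (-m²)`, times `θ` if
`m ≠ 0`. Every grid point has product weight at least `θ ^ s * exp (-100 s)`, while the total weight
of the box is at most `(1 + 2θ) ^ d ≤ exp (2 s)`. -/
theorem card_sparseGrid_le {d s : ℕ} (hs : 0 < s) (hsd : s ≤ d) :
    ((sparseGrid d s).card : ℝ) ≤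
      Real.exp (102 * (s * Real.log (Real.exp 1 * d / s))) := by
  have hs' : (0 : ℝ) < s := by exact_mod_cast hs
  have hd' : (0 : ℝ) < d := by exact_mod_cast hs.trans_le hsd
  have hsd' : (s : ℝ) ≤ d := by exact_mod_cast hsd
  obtain ⟨θ, hθ⟩ : ∃ θ : ℝ, θ = s / d := ⟨_, rfl⟩
  have hθ0 : 0 < θ := by rw [hθ]; positivity
  have hθ1 : θ ≤ 1 := by rw [hθ]; exact div_le_one_of_le₀ hsd' hd'.le
  let f : ℤ → ℝ := fun m => (if m = 0 then 1 else θ) * Real.exp (-(m : ℝ) ^ 2)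
  have hf0 : ∀ m, 0 ≤ f m := fun m => by simp only [f]; split_ifs <;> positivity
  have hlow : ∀ z ∈ sparseGrid d s, θ ^ s * Real.exp (-(100 * s)) ≤ ∏ j, f (z j) := by
    intro z hz
    obtain ⟨h1, h2⟩ := mem_sparseGrid.1 hz
    simp only [f]
    rw [Finset.prod_mul_distrib, ← Real.exp_sum]
    have e1 : ∏ j, (if z j = 0 then (1 : ℝ) else θ) =
        θ ^ (Finset.univ.filter fun j => z j ≠ 0).card := by
      rw [Finset.prod_ite]; simp
    have e2 : ∑ j, (z j : ℝ) ^ 2 ≤ 100 * s := by exact_mod_cast h2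
    rw [e1, Finset.sum_neg_distrib]
    have e3 := pow_le_pow_of_le_one hθ0.le hθ1 h1
    gcongr
  have hup : ∑ z ∈ sparseGrid d s, ∏ j, f (z j) ≤ Real.exp (2 * s) := by
    calc ∑ z ∈ sparseGrid d s, ∏ j, f (z j)
        ≤ ∑ z ∈ Fintype.piFinset fun _ : Fin d =>
            Finset.Icc (-((100 * s : ℕ) : ℤ)) (100 * s : ℕ), ∏ j, f (z j) :=
          Finset.sum_le_sum_of_subset_of_nonneg (Finset.filter_subset _ _)
            fun z _ _ => Finset.prod_nonneg fun j _ => hf0 _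
      _ = ∏ _j : Fin d, ∑ m ∈ Finset.Icc (-((100 * s : ℕ) : ℤ)) (100 * s : ℕ), f m := by
          rw [Finset.prod_univ_sum]
      _ ≤ ∏ _j : Fin d, Real.exp (2 * θ) := by
          refine Finset.prod_le_prod (fun _ _ => Finset.sum_nonneg fun m _ => hf0 m) fun _ _ => ?_
          refine (sum_Icc_weight_le hθ0.le _).trans ?_
          linarith [Real.add_one_le_exp (2 * θ)]
      _ = Real.exp (2 * s) := by
          rw [Finset.prod_const, ← Real.exp_nat_mul, hθ]
          congr 1
          simp only [Finset.card_univ, Fintype.card_fin]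
          field_simp
  have hcard := (Finset.card_nsmul_le_sum _ _ _ hlow).trans hup
  rw [nsmul_eq_mul] at hcard
  have hL : Real.log (Real.exp 1 * d / s) = 1 - Real.log θ := by
    rw [hθ, mul_div_assoc, Real.log_mul (by positivity) (by positivity), Real.log_exp,
      Real.log_div hd'.ne' hs'.ne', Real.log_div hs'.ne' hd'.ne']
    ring
  have hlog : Real.log θ ≤ 0 := Real.log_nonpos hθ0.le hθ1
  have hpow : θ ^ s = Real.exp (s * Real.log θ) := by
    rw [Real.exp_nat_mul, Real.exp_log hθ0]
  rw [hpow, ← Real.exp_add, ← le_div_iff₀ (Real.exp_pos _), ← Real.exp_sub] at hcard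
  refine hcard.trans (Real.exp_le_exp.2 ?_)
  rw [hL]
  nlinarith

/-- Rounding of a real number to an integer, towards zero. -/
noncomputable def roundToZero (t : ℝ) : ℤ := if 0 ≤ t then ⌊t⌋ else ⌈t⌉

theorem roundToZero_zero : roundToZero 0 = 0 := by simp [roundToZero]

theorem abs_roundToZero_le (t : ℝ) : |(roundToZero t : ℝ)| ≤ |t| := by
  unfold roundToZero
  split_ifs with h
  · rw [abs_of_nonneg h, abs_of_nonneg (by exact_mod_cast Int.floor_nonneg.2 h)]
    exact Int.floor_le t
  · push Not at h
    rw [abs_of_neg h, abs_of_nonpos (by exact_mod_cast Int.ceil_le.2 (by simpa using h.le))]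
    linarith [Int.le_ceil t]

theorem abs_sub_roundToZero_le (t : ℝ) : |t - roundToZero t| ≤ 1 := by
  unfold roundToZero
  split_ifs with h
  · rw [abs_le]; constructor <;> linarith [Int.floor_le t, Int.lt_floor_add_one t]
  · rw [abs_le]; constructor <;> linarith [Int.le_ceil t, Int.ceil_lt_add_one t]

/-- Round each coordinate towards zero on a lattice of mesh `1 / (10 √s)`. Zero coordinates stay
zero and moduli do not grow, so sparsity and the unit ball are preserved; at most `s` coordinates
move, giving distance at most `1/10`. -/
theorem exists_sparse_net {d s : ℕ} (hs : 0 < s) (hsd : s ≤ d) :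
    ∃ N : Finset (EuclideanSpace ℝ (Fin d)),
      (N.card : ℝ) ≤ Real.exp (102 * (s * Real.log (Real.exp 1 * d / s))) ∧
      (∀ v ∈ N, ‖v‖ ≤ 1) ∧
      ∀ u, zeroNorm u ≤ s → ‖u‖ ≤ 1 → ∃ v ∈ N, ‖u - v‖ ≤ 1 / 10 ∧ zeroNorm (u - v) ≤ s := by
  classical
  have hs' : (0 : ℝ) < s := by exact_mod_cast hs
  obtain ⟨r, hr0, hr⟩ : ∃ r : ℝ, 0 < r ∧ r ^ 2 = 100 * s :=
    ⟨√(100 * s), by positivity, Real.sq_sqrt (by positivity)⟩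
  let φ : (Fin d → ℤ) → EuclideanSpace ℝ (Fin d) := fun z => WithLp.toLp 2 fun j => (z j : ℝ) / r
  refine ⟨(sparseGrid d s).image φ, ?_, ?_, ?_⟩
  · exact le_trans (by exact_mod_cast Finset.card_image_le) (card_sparseGrid_le hs hsd)
  · intro v hv
    obtain ⟨z, hz, rfl⟩ := Finset.mem_image.1 hv
    have h2 : ∑ j, (z j : ℝ) ^ 2 ≤ 100 * s := by exact_mod_cast (mem_sparseGrid.1 hz).2
    rw [← sq_le_one_iff₀ (norm_nonneg _), EuclideanSpace.real_norm_sq_eq]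
    simp only [φ, div_pow]
    rw [← Finset.sum_div, hr]
    exact div_le_one_of_le₀ h2 (by positivity)
  · intro u hus hu
    have hu2 : ∑ j, u j ^ 2 ≤ 1 := by
      rw [← EuclideanSpace.real_norm_sq_eq]; nlinarith [norm_nonneg u]
    let z : Fin d → ℤ := fun j => roundToZero (u j * r)
    have hz0 : ∀ j, u j = 0 → z j = 0 := fun j hj => by simp [z, hj, roundToZero_zero]
    have hφ : ∀ j, u j = 0 → (u - φ z) j = 0 := fun j hj => by simp [φ, hz0 j hj, hj]
    have habs : ∀ j, (u - φ z) j ^ 2 ≤ 1 / r ^ 2 := by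
      intro j
      have e : (u - φ z) j = (u j * r - z j) / r := by
        simp only [φ, PiLp.sub_apply]; field_simp
      rw [e, div_pow]
      gcongr
      rw [sq_le_one_iff_abs_le_one]
      exact abs_sub_roundToZero_le _
    refine ⟨φ z, Finset.mem_image_of_mem _ (mem_sparseGrid.2 ⟨?_, ?_⟩), ?_, ?_⟩
    · refine (Finset.card_le_card fun j => ?_).trans hus
      simp only [supp, Finset.mem_filter, Finset.mem_univ, true_and]
      exact mt (hz0 j)
    · have h1 : ∀ j, (z j : ℝ) ^ 2 ≤ u j ^ 2 * r ^ 2 := fun j => by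
        rw [← mul_pow]; exact sq_le_sq.2 (abs_roundToZero_le _)
      have h2 : ∑ j, (z j : ℝ) ^ 2 ≤ 100 * s := by
        calc ∑ j, (z j : ℝ) ^ 2 ≤ ∑ j, u j ^ 2 * r ^ 2 := Finset.sum_le_sum fun j _ => h1 j
          _ ≤ 1 * r ^ 2 := by rw [← Finset.sum_mul]; gcongr
          _ = _ := by rw [one_mul, hr]
      exact_mod_cast h2
    · have h1 : ∑ j, (u - φ z) j ^ 2 ≤ s * (1 / r ^ 2) := by
        rw [← Finset.sum_subset (Finset.subset_univ (supp u)) fun j _ hj => by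
          rw [hφ j (by simpa [supp] using hj)]; norm_num]
        refine (Finset.sum_le_card_nsmul _ _ _ fun j _ => habs j).trans ?_
        rw [nsmul_eq_mul]
        gcongr
        exact hus
      rw [← EuclideanSpace.real_norm_sq_eq, hr] at h1
      have h2 : (s : ℝ) * (1 / (100 * s)) = (1 / 10) ^ 2 := by field_simp; norm_num
      rw [h2] at h1
      exact (pow_le_pow_iff_left₀ (norm_nonneg _) (by norm_num) two_ne_zero).1 h1
    · refine (Finset.card_le_card fun j => ?_).trans hus
      simp only [supp, Finset.mem_filter, Finset.mem_univ, true_and]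
      exact mt (hφ j)

end SparseLogistic

/-! ### Calculus of the logistic loss -/

namespace SparseLogistic

theorem quadratic_lower_bound_of_le {f f' f'' : ℝ → ℝ} (hf : ∀ t, HasDerivAt f (f' t) t)
    (hf' : ∀ t, HasDerivAt f' (f'' t) t) {a b m : ℝ} (hab : a ≤ b)
    (hm : ∀ t ∈ Set.Icc a b, m ≤ f'' t) :
    m / 2 * (b - a) ^ 2 ≤ f b - f a - f' a * (b - a) := by
  have h1 : ∀ t, HasDerivAt (fun t => f' t - m * t) (f'' t - m) t := fun t =>
    ((hf' t).sub ((hasDerivAt_id t).const_mul m)).congr_deriv (by simp)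
  have mono1 : MonotoneOn (fun t => f' t - m * t) (Set.Icc a b) :=
    monotoneOn_of_deriv_nonneg (convex_Icc a b)
      (fun t _ => (h1 t).continuousAt.continuousWithinAt)
      (fun t _ => (h1 t).differentiableAt.differentiableWithinAt) fun t ht => by
        rw [(h1 t).deriv]; linarith [hm t (interior_subset ht)]
  have h2 : ∀ t, HasDerivAt (fun t => f t - f' a * t - m / 2 * (t - a) ^ 2)
      (f' t - f' a - m * (t - a)) t := fun t => by
    have := ((hf t).sub ((hasDerivAt_id t).const_mul (f' a))).sub
      ((((hasDerivAt_id t).sub_const a).pow 2).const_mul (m / 2))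
    refine this.congr_deriv ?_
    simp; ring
  have mono2 : MonotoneOn (fun t => f t - f' a * t - m / 2 * (t - a) ^ 2) (Set.Icc a b) :=
    monotoneOn_of_deriv_nonneg (convex_Icc a b)
      (fun t _ => (h2 t).continuousAt.continuousWithinAt)
      (fun t _ => (h2 t).differentiableAt.differentiableWithinAt) fun t ht => by
        rw [(h2 t).deriv]
        have ht' := interior_subset ht
        have := mono1 (Set.left_mem_Icc.2 hab) ht' ht'.1
        simp only at this
        linarith
  have := mono2 (Set.left_mem_Icc.2 hab) (Set.right_mem_Icc.2 hab) hab
  simp only at this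
  linarith

/-- Second-order Taylor bound; the case `b ≤ a` follows by reflecting `t ↦ -t`. -/
theorem quadratic_lower_bound {f f' f'' : ℝ → ℝ} (hf : ∀ t, HasDerivAt f (f' t) t)
    (hf' : ∀ t, HasDerivAt f' (f'' t) t) {a b m : ℝ} (hm : ∀ t ∈ Set.uIcc a b, m ≤ f'' t) :
    m / 2 * (b - a) ^ 2 ≤ f b - f a - f' a * (b - a) := by
  rcases le_total a b with hab | hab
  · exact quadratic_lower_bound_of_le hf hf' hab (by rwa [Set.uIcc_of_le hab] at hm)
  · rw [Set.uIcc_of_ge hab] at hm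
    have h1 : ∀ t, HasDerivAt (fun t => f (-t)) (-f' (-t)) t := fun t =>
      ((hf (-t)).comp t (hasDerivAt_neg t)).congr_deriv (by simp)
    have h2 : ∀ t, HasDerivAt (fun t => -f' (-t)) (f'' (-t)) t := fun t =>
      ((hf' (-t)).comp t (hasDerivAt_neg t)).neg.congr_deriv (by simp)
    have := quadratic_lower_bound_of_le h1 h2 (a := -a) (b := -b) (m := m) (by linarith)
      fun t ht => hm (-t) ⟨by linarith [ht.2], by linarith [ht.1]⟩
    simp only [neg_neg] at this
    nlinarith

/-- The logistic loss of a margin `t`. -/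
noncomputable def logLoss (t : ℝ) : ℝ := Real.log (1 + Real.exp (-2 * t))

/-- The derivative of `logLoss`. -/
noncomputable def logLossDeriv (t : ℝ) : ℝ := -2 / (1 + Real.exp (2 * t))

/-- The second derivative of `logLoss`. -/
noncomputable def logLossDeriv2 (t : ℝ) : ℝ := 4 * Real.exp (2 * t) / (1 + Real.exp (2 * t)) ^ 2

theorem hasDerivAt_logLoss (t : ℝ) : HasDerivAt logLoss (logLossDeriv t) t := by
  have h1 : HasDerivAt (fun t : ℝ => 1 + Real.exp (-2 * t)) (Real.exp (-2 * t) * -2) t := by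
    simpa using (((hasDerivAt_id t).const_mul (-2)).exp).const_add 1
  have hp : 0 < 1 + Real.exp (-2 * t) := by positivity
  refine (h1.log hp.ne').congr_deriv ?_
  have e : Real.exp (2 * t) * Real.exp (-2 * t) = 1 := by
    rw [← Real.exp_add]; ring_nf; exact Real.exp_zero
  have hq : 0 < 1 + Real.exp (2 * t) := by positivity
  rw [logLossDeriv, div_eq_div_iff hp.ne' hq.ne']
  linear_combination (-2) * e

theorem hasDerivAt_logLossDeriv (t : ℝ) : HasDerivAt logLossDeriv (logLossDeriv2 t) t := by
  have h1 : HasDerivAt (fun t : ℝ => 1 + Real.exp (2 * t)) (Real.exp (2 * t) * 2) t := by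
    simpa using (((hasDerivAt_id t).const_mul 2).exp).const_add 1
  have hq : 0 < 1 + Real.exp (2 * t) := by positivity
  refine ((hasDerivAt_const t (-2 : ℝ)).div h1 hq.ne').congr_deriv ?_
  rw [logLossDeriv2]; ring

theorem logLossDeriv2_nonneg (t : ℝ) : 0 ≤ logLossDeriv2 t := by
  unfold logLossDeriv2; positivity

theorem logLossDeriv2_le_one (t : ℝ) : logLossDeriv2 t ≤ 1 := by
  unfold logLossDeriv2
  apply div_le_one_of_le₀ _ (by positivity)
  nlinarith [sq_nonneg (1 - Real.exp (2 * t))]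

theorem half_le_logLossDeriv2 {t : ℝ} (ht : |t| ≤ 1 / 2) : 1 / 2 ≤ logLossDeriv2 t := by
  rw [abs_le] at ht
  have h3 := Real.exp_one_lt_d9
  have h1 : Real.exp (2 * t) ≤ 3 := by
    have : Real.exp (2 * t) ≤ Real.exp 1 := Real.exp_le_exp.2 (by linarith)
    linarith
  have h2 : 1 / 3 ≤ Real.exp (2 * t) := by
    have h4 : Real.exp (-(2 * t)) ≤ Real.exp 1 := Real.exp_le_exp.2 (by linarith)
    have h5 : Real.exp (2 * t) * Real.exp (-(2 * t)) = 1 := by rw [← Real.exp_add]; simp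
    nlinarith [Real.exp_pos (2 * t)]
  unfold logLossDeriv2
  rw [div_le_div_iff₀ (by norm_num) (by positivity)]
  nlinarith

theorem logLoss_bregman_nonneg (a b : ℝ) :
    0 ≤ logLoss b - logLoss a - logLossDeriv a * (b - a) := by
  simpa using quadratic_lower_bound hasDerivAt_logLoss hasDerivAt_logLossDeriv (a := a) (b := b)
    (m := 0) fun t _ => logLossDeriv2_nonneg t

theorem logLoss_bregman_ge {a b : ℝ} (ha : |a| ≤ 1 / 2) (hb : |b| ≤ 1 / 2) :
    1 / 4 * (b - a) ^ 2 ≤ logLoss b - logLoss a - logLossDeriv a * (b - a) := by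
  have := quadratic_lower_bound hasDerivAt_logLoss hasDerivAt_logLossDeriv (a := a) (b := b)
    (m := 1 / 2) fun t ht => half_le_logLossDeriv2 (by
      rw [abs_le] at *
      rw [Set.mem_uIcc] at ht
      rcases ht with h | h <;> constructor <;> linarith [h.1, h.2])
  linarith

theorem abs_logLossDeriv_sub_le (a b : ℝ) :
    |logLossDeriv b - logLossDeriv a| ≤ |b - a| := by
  have := Convex.norm_image_sub_le_of_norm_hasDerivWithin_le (f := logLossDeriv)
    (f' := logLossDeriv2) (s := Set.univ) (C := 1) (x := a) (y := b)
    (fun t _ => (hasDerivAt_logLossDeriv t).hasDerivWithinAt)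
    (fun t _ => by
      rw [Real.norm_of_nonneg (logLossDeriv2_nonneg t)]; exact logLossDeriv2_le_one t)
    convex_univ (Set.mem_univ _) (Set.mem_univ _)
  simpa using this

variable {n d : ℕ}

/-- `rowDot` as a continuous linear functional of the vector. -/
noncomputable def rowFunctional (A : Matrix (Fin n) (Fin d) ℝ) (i : Fin n) :
    EuclideanSpace ℝ (Fin d) →L[ℝ] ℝ :=
  innerSL ℝ (WithLp.toLp 2 (A i))

theorem rowFunctional_apply (A : Matrix (Fin n) (Fin d) ℝ) (i : Fin n)
    (x : EuclideanSpace ℝ (Fin d)) : rowFunctional A i x = rowDot A x i := by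
  simp [rowFunctional, rowDot, PiLp.inner_apply, mul_comm]

theorem logisticLoss_eq (A : Matrix (Fin n) (Fin d) ℝ) (y : Fin n → ℝ) (γ : ℝ) :
    logisticLoss A y γ = fun x =>
      1 / (n : ℝ) * ∑ i, logLoss (y i * rowFunctional A i x) + γ / 2 * ‖x‖ ^ 2 := by
  ext x
  simp only [logisticLoss, logLoss, rowFunctional_apply, rowDot, mul_assoc]

theorem hasFDerivAt_logisticLoss (A : Matrix (Fin n) (Fin d) ℝ) (y : Fin n → ℝ) (γ : ℝ)
    (x : EuclideanSpace ℝ (Fin d)) :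
    HasFDerivAt (logisticLoss A y γ)
      ((1 / (n : ℝ)) • ∑ i, logLossDeriv (y i * rowFunctional A i x) • y i • rowFunctional A i +
        (γ / 2) • (2 • innerSL ℝ x)) x := by
  rw [logisticLoss_eq]
  refine HasFDerivAt.add (HasFDerivAt.const_mul (HasFDerivAt.fun_sum fun i _ => ?_) _) ?_
  · exact (hasDerivAt_logLoss _).comp_hasFDerivAt x
      ((rowFunctional A i).hasFDerivAt.const_mul (y i))
  · exact (hasStrictFDerivAt_norm_sq x).hasFDerivAt.const_mul _

theorem inner_gradient_logisticLoss (A : Matrix (Fin n) (Fin d) ℝ) (y : Fin n → ℝ) (γ : ℝ)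
    (x h : EuclideanSpace ℝ (Fin d)) :
    inner ℝ (gradient (logisticLoss A y γ) x) h =
      1 / (n : ℝ) * ∑ i, logLossDeriv (y i * rowDot A x i) * (y i * rowDot A h i) +
        γ * inner ℝ x h := by
  rw [gradient, InnerProductSpace.toDual_symm_apply, (hasFDerivAt_logisticLoss A y γ x).fderiv]
  simp [rowFunctional_apply]
  ring

end SparseLogistic

/-! ### From the net to restricted smoothness and strong convexity -/

namespace SparseLogistic

variable {n d : ℕ}

theorem zeroNorm_zero : zeroNorm (0 : EuclideanSpace ℝ (Fin d)) = 0 := by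
  simp [zeroNorm, supp]

theorem zeroNorm_smul_le (c : ℝ) (u : EuclideanSpace ℝ (Fin d)) :
    zeroNorm (c • u) ≤ zeroNorm u := by
  refine Finset.card_le_card fun j => ?_
  simp only [supp, Finset.mem_filter, Finset.mem_univ, true_and]
  exact mt fun hj => by simp [hj]

theorem zeroNorm_proj_le (S : Finset (Fin d)) (u : EuclideanSpace ℝ (Fin d)) :
    zeroNorm (proj S u) ≤ S.card := by
  refine Finset.card_le_card fun j => ?_
  simp only [supp, proj, Finset.mem_filter, Finset.mem_univ, true_and]
  intro h
  by_contra hj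
  simp [hj] at h

theorem inner_proj_self (S : Finset (Fin d)) (u : EuclideanSpace ℝ (Fin d)) :
    inner ℝ u (proj S u) = ‖proj S u‖ ^ 2 := by
  rw [EuclideanSpace.real_norm_sq_eq, PiLp.inner_apply]
  refine Finset.sum_congr rfl fun j _ => ?_
  by_cases hj : j ∈ S <;> simp [proj, hj, sq]

/-- A bound for a linear map on a net of the sparse unit ball extends to all sparse vectors. -/
theorem norm_le_of_sparse_net {F : Type*} [NormedAddCommGroup F] [NormedSpace ℝ F] {s : ℕ}
    (T : EuclideanSpace ℝ (Fin d) →L[ℝ] F) {N : Finset (EuclideanSpace ℝ (Fin d))}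
    (hN : ∀ u, zeroNorm u ≤ s → ‖u‖ ≤ 1 → ∃ v ∈ N, ‖u - v‖ ≤ 1 / 10 ∧ zeroNorm (u - v) ≤ s)
    {b : ℝ} (hb : ∀ v ∈ N, ‖T v‖ ≤ b) {u : EuclideanSpace ℝ (Fin d)} (hu : zeroNorm u ≤ s) :
    ‖T u‖ ≤ 10 / 9 * b * ‖u‖ := by
  let S : Set ℝ := {t | ∃ u, zeroNorm u ≤ s ∧ ‖u‖ ≤ 1 ∧ ‖T u‖ = t}
  have hbdd : BddAbove S := by
    refine ⟨‖T‖, ?_⟩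
    rintro _ ⟨u, -, h, rfl⟩
    exact (T.le_opNorm u).trans (mul_le_of_le_one_right (norm_nonneg _) h)
  have hne : S.Nonempty := ⟨‖T 0‖, 0, by simp [zeroNorm_zero], by simp, rfl⟩
  have hscale : ∀ u, zeroNorm u ≤ s → ∀ r > 0, ‖u‖ ≤ r → ‖T u‖ ≤ r * sSup S := by
    intro u hu r hr hur
    have h1 : ‖T (r⁻¹ • u)‖ ≤ sSup S := by
      refine le_csSup hbdd ⟨r⁻¹ • u, (zeroNorm_smul_le _ _).trans hu, ?_, rfl⟩
      rw [norm_smul, Real.norm_of_nonneg (by positivity), inv_mul_le_iff₀ hr]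
      simpa using hur
    rwa [map_smul, norm_smul, Real.norm_of_nonneg (by positivity), inv_mul_le_iff₀ hr] at h1
  -- The error `u - v` is again `s`-sparse, so the supremum bounds itself and is at most `10/9 * b`.
  have hsup : sSup S ≤ b + 1 / 10 * sSup S := by
    refine csSup_le hne ?_
    rintro _ ⟨u, hu, hu1, rfl⟩
    obtain ⟨v, hv, huv, hz⟩ := hN u hu hu1
    have h1 := hscale (u - v) hz (1 / 10) (by norm_num) huv
    have h2 : T u = T v + T (u - v) := by simp
    rw [h2]
    exact (norm_add_le _ _).trans (add_le_add (hb v hv) h1)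
  rcases (norm_nonneg u).eq_or_lt with h0 | h0
  · have : u = 0 := norm_eq_zero.1 h0.symm
    simp [this]
  · refine (hscale u hu ‖u‖ h0 le_rfl).trans ?_
    nlinarith

/-- Multiplication by `A`, as a map between Euclidean spaces. -/
noncomputable def rowMap (A : Matrix (Fin n) (Fin d) ℝ) :
    EuclideanSpace ℝ (Fin d) →L[ℝ] EuclideanSpace ℝ (Fin n) :=
  (Matrix.toEuclideanLin A).toContinuousLinearMap

theorem rowMap_apply (A : Matrix (Fin n) (Fin d) ℝ) (x : EuclideanSpace ℝ (Fin d)) (i : Fin n) :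
    rowMap A x i = rowDot A x i := by
  simp [rowMap, rowDot, Matrix.toLpLin_apply, Matrix.mulVec, dotProduct]

theorem norm_rowMap_sq (A : Matrix (Fin n) (Fin d) ℝ) (x : EuclideanSpace ℝ (Fin d)) :
    ‖rowMap A x‖ ^ 2 = ∑ i, rowDot A x i ^ 2 := by
  rw [EuclideanSpace.real_norm_sq_eq]
  simp_rw [rowMap_apply]

theorem rowDot_sub (A : Matrix (Fin n) (Fin d) ℝ) (x y : EuclideanSpace ℝ (Fin d)) (i : Fin n) :
    rowDot A (x - y) i = rowDot A x i - rowDot A y i := by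
  simp [← rowFunctional_apply]

theorem rowDot_smul (A : Matrix (Fin n) (Fin d) ℝ) (c : ℝ) (x : EuclideanSpace ℝ (Fin d))
    (i : Fin n) : rowDot A (c • x) i = c * rowDot A x i := by
  simp [← rowFunctional_apply]

/-- The two-sided control of the quadratic form of `A` on `s`-sparse vectors, the lower one for
squares truncated at level `B`; `q` is the reference value of the form on the unit sphere. -/
structure TruncatedRestrictedIsometry (A : Matrix (Fin n) (Fin d) ℝ) (s : ℕ) (q B : ℝ) :
    Prop where
  upper : ∀ u, zeroNorm u ≤ s → ∑ i, rowDot A u i ^ 2 ≤ 1.36 * q * ‖u‖ ^ 2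
  lower : ∀ u, zeroNorm u ≤ s →
    0.52 * q * ‖u‖ ^ 2 ≤ ∑ i, min (rowDot A u i ^ 2) (B * ‖u‖ ^ 2)

theorem abs_min_abs_sub_le (R a b : ℝ) : |min |a| R - min |b| R| ≤ |a - b| :=
  (abs_min_sub_min_le_max _ _ _ _).trans (by simpa using abs_abs_sub_abs_le a b)

/-- The upper bound is `(10/9)² * 1.1 ≤ 1.36`. The truncated form is not quadratic, but it is the
squared norm of `ψ`, whose coordinates are `1`-Lipschitz functions of the row products; so moving
from `u` to the net costs at most the untruncated form at `u - v`. With `‖v‖ ≥ 0.9` this leaves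
`(0.84 - 0.117)² ≥ 0.52`. -/
theorem TruncatedRestrictedIsometry.of_net {A : Matrix (Fin n) (Fin d) ℝ} {s : ℕ} {q B : ℝ}
    (hq : 0 ≤ q) (hB : 0 ≤ B) {N : Finset (EuclideanSpace ℝ (Fin d))}
    (hN : ∀ u, zeroNorm u ≤ s → ‖u‖ ≤ 1 → ∃ v ∈ N, ‖u - v‖ ≤ 1 / 10 ∧ zeroNorm (u - v) ≤ s)
    (hN1 : ∀ v ∈ N, ‖v‖ ≤ 1)
    (hup : ∀ v ∈ N, ∑ i, rowDot A v i ^ 2 ≤ q * (‖v‖ ^ 2 + 1 / 10))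
    (hlow : ∀ v ∈ N, q * (‖v‖ ^ 2 - 1 / 10) ≤ ∑ i, min (rowDot A v i ^ 2) B) :
    TruncatedRestrictedIsometry A s q B := by
  have hT : ∀ u, zeroNorm u ≤ s → ‖rowMap A u‖ ≤ 10 / 9 * √(1.1 * q) * ‖u‖ := by
    intro u hu
    refine norm_le_of_sparse_net (rowMap A) hN (fun v hv => ?_) hu
    apply Real.le_sqrt_of_sq_le
    rw [norm_rowMap_sq]
    have h1 := hup v hv
    have h2 := mul_le_mul_of_nonneg_left (pow_le_one₀ (n := 2) (norm_nonneg v) (hN1 v hv)) hq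
    linarith
  have hupper : ∀ u, zeroNorm u ≤ s → ∑ i, rowDot A u i ^ 2 ≤ 1.36 * q * ‖u‖ ^ 2 := by
    intro u hu
    rw [← norm_rowMap_sq]
    refine (pow_le_pow_left₀ (norm_nonneg _) (hT u hu) 2).trans ?_
    rw [mul_pow, mul_pow, Real.sq_sqrt (by positivity)]
    nlinarith [mul_nonneg hq (sq_nonneg ‖u‖)]
  refine ⟨hupper, ?_⟩
  have hunit : ∀ u, zeroNorm u ≤ s → ‖u‖ = 1 →
      0.52 * q ≤ ∑ i, min (rowDot A u i ^ 2) B := by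
    intro u hu hu1
    obtain ⟨v, hv, huv, hz⟩ := hN u hu hu1.le
    let ψ : EuclideanSpace ℝ (Fin d) → EuclideanSpace ℝ (Fin n) :=
      fun u => WithLp.toLp 2 fun i => min |rowDot A u i| √B
    have hψ : ∀ u, ‖ψ u‖ ^ 2 = ∑ i, min (rowDot A u i ^ 2) B := by
      intro u
      rw [EuclideanSpace.real_norm_sq_eq]
      refine Finset.sum_congr rfl fun i _ => ?_
      simp only [ψ]
      rcases le_total |rowDot A u i| √B with h | h
      · rw [min_eq_left h, sq_abs, min_eq_left]
        rw [← sq_abs]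
        exact (Real.le_sqrt (abs_nonneg _) hB).1 h
      · rw [min_eq_right h, Real.sq_sqrt hB, min_eq_right]
        rw [← sq_abs]
        exact (Real.sqrt_le_left (abs_nonneg _)).1 h
    have hdiff : ‖ψ v - ψ u‖ ^ 2 ≤ ∑ i, rowDot A (u - v) i ^ 2 := by
      rw [EuclideanSpace.real_norm_sq_eq]
      refine Finset.sum_le_sum fun i _ => ?_
      rw [rowDot_sub, sub_sq_comm (rowDot A u i)]
      exact sq_le_sq.2 (abs_min_abs_sub_le _ _ _)
    have h1 : ‖ψ v - ψ u‖ ^ 2 ≤ (0.117 * √q) ^ 2 := by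
      rw [mul_pow, Real.sq_sqrt hq]
      have h2 := hdiff.trans (hupper _ hz)
      have h3 : ‖u - v‖ ^ 2 ≤ (1 / 10) ^ 2 := by gcongr
      nlinarith
    have h2 : (0.84 * √q) ^ 2 ≤ ‖ψ v‖ ^ 2 := by
      rw [mul_pow, Real.sq_sqrt hq, hψ]
      have h3 : 0.9 ≤ ‖v‖ := by
        have := norm_sub_norm_le u v
        rw [hu1] at this
        linarith
      have h4 := hlow v hv
      have h5 : 0.81 ≤ ‖v‖ ^ 2 := by nlinarith
      have h6 := mul_le_mul_of_nonneg_left h5 hq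
      linarith
    have h3 := (pow_le_pow_iff_left₀ (norm_nonneg _) (by positivity) two_ne_zero).1 h1
    have h4 := (pow_le_pow_iff_left₀ (by positivity) (norm_nonneg _) two_ne_zero).1 h2
    have h5 : 0.723 * √q ≤ ‖ψ u‖ := by
      have := norm_sub_norm_le (ψ v) (ψ u)
      linarith
    have h6 := pow_le_pow_left₀ (by positivity) h5 2
    rw [mul_pow, Real.sq_sqrt hq, hψ] at h6
    linarith
  intro u hu
  rcases (norm_nonneg u).eq_or_lt with h0 | h0
  · rw [← h0]
    simpa using Finset.sum_nonneg fun i _ => le_min (sq_nonneg (rowDot A u i)) le_rfl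
  · have h1 := hunit (‖u‖⁻¹ • u) ((zeroNorm_smul_le _ _).trans hu)
      (by rw [norm_smul, norm_inv, norm_norm, inv_mul_cancel₀ h0.ne'])
    have h2 : ∑ i, min (rowDot A u i ^ 2) (B * ‖u‖ ^ 2) =
        (∑ i, min (rowDot A (‖u‖⁻¹ • u) i ^ 2) B) * ‖u‖ ^ 2 := by
      rw [Finset.sum_mul]
      refine Finset.sum_congr rfl fun i _ => ?_
      rw [min_mul_of_nonneg _ _ (sq_nonneg _), rowDot_smul]
      congr 1
      field_simp
    rw [h2]
    gcongr

variable {A : Matrix (Fin n) (Fin d) ℝ} {y : Fin n → ℝ} {γ : ℝ}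

/-- With `w` the gradient difference and `v` its projection, `‖v‖² = ⟨w, v⟩`. Both `v` and `x' - x`
are `s`-sparse, so Cauchy–Schwarz over the rows, `ℓ'` being `1`-Lipschitz, reduces to the upper
isometry bound twice. -/
theorem restrictedSmoothness_logisticLoss {s r : ℕ} {V B : ℝ} (hn : 0 < n)
    (hA : TruncatedRestrictedIsometry A s (n * V) B) (hV : 0 ≤ V) (hγ : 0 ≤ γ) (hr : r ≤ s)
    (hy : ∀ i, y i = 1 ∨ y i = -1) (D : Set (EuclideanSpace ℝ (Fin d))) :
    RestrictedSmoothness (logisticLoss A y γ) D r (1.36 * V + γ) := by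
  have hn' : (0 : ℝ) < n := by exact_mod_cast hn
  refine ⟨fun x => (hasFDerivAt_logisticLoss A y γ x).differentiableAt, by positivity, ?_⟩
  intro x _ x' _ S hS hsupp
  set w := gradient (logisticLoss A y γ) x' - gradient (logisticLoss A y γ) x with hw
  set v := proj S w with hv
  have hvs : zeroNorm v ≤ s := (zeroNorm_proj_le S w).trans (hS.trans hr)
  have hhs : zeroNorm (x' - x) ≤ s := by
    have h1 := zeroNorm_smul_le (-1) (x - x')
    rw [neg_one_smul, neg_sub] at h1
    exact h1.trans ((Finset.card_le_card hsupp).trans (hS.trans hr))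
  let g : Fin n → ℝ := fun i =>
    (logLossDeriv (y i * rowDot A x' i) - logLossDeriv (y i * rowDot A x i)) * y i
  have hg : ∀ i, g i ^ 2 ≤ rowDot A (x' - x) i ^ 2 := by
    intro i
    have h1 := sq_le_sq.2 (abs_logLossDeriv_sub_le (y i * rowDot A x i) (y i * rowDot A x' i))
    have h2 : y i ^ 2 = 1 := by rcases hy i with h | h <;> rw [h] <;> norm_num
    rw [← mul_sub, mul_pow, h2, one_mul, ← rowDot_sub] at h1
    simpa only [g, mul_pow, h2, mul_one] using h1
  have hinner : ‖v‖ ^ 2 = 1 / (n : ℝ) * ∑ i, g i * rowDot A v i + γ * inner ℝ (x' - x) v := by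
    rw [hv, ← inner_proj_self, ← hv, hw, inner_sub_left, inner_gradient_logisticLoss,
      inner_gradient_logisticLoss, inner_sub_left]
    have : ∑ i, g i * rowDot A v i =
        ∑ i, logLossDeriv (y i * rowDot A x' i) * (y i * rowDot A v i) -
          ∑ i, logLossDeriv (y i * rowDot A x i) * (y i * rowDot A v i) := by
      rw [← Finset.sum_sub_distrib]
      exact Finset.sum_congr rfl fun i _ => by simp only [g]; ring
    rw [this]
    ring
  have hcs : ∑ i, g i * rowDot A v i ≤ 1.36 * (n * V) * ‖x' - x‖ * ‖v‖ := by
    refine abs_le_of_sq_le_sq' ?_ (by positivity) |>.2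
    calc (∑ i, g i * rowDot A v i) ^ 2 ≤ (∑ i, g i ^ 2) * ∑ i, rowDot A v i ^ 2 :=
          Finset.sum_mul_sq_le_sq_mul_sq _ _ _
      _ ≤ (1.36 * (n * V) * ‖x' - x‖ ^ 2) * (1.36 * (n * V) * ‖v‖ ^ 2) := by
          exact mul_le_mul ((Finset.sum_le_sum fun i _ => hg i).trans (hA.upper _ hhs))
            (hA.upper _ hvs) (Finset.sum_nonneg fun i _ => sq_nonneg _) (by positivity)
      _ = _ := by ring
  have hfin : ‖v‖ ^ 2 ≤ (1.36 * V + γ) * ‖x' - x‖ * ‖v‖ := by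
    rw [hinner]
    have h1 := mul_le_mul_of_nonneg_left hcs (show 0 ≤ 1 / (n : ℝ) by positivity)
    have h2 := mul_le_mul_of_nonneg_left (real_inner_le_norm (x' - x) v) hγ
    have h3 : 1 / (n : ℝ) * (1.36 * (n * V) * ‖x' - x‖ * ‖v‖) = 1.36 * V * ‖x' - x‖ * ‖v‖ := by
      field_simp
    linarith
  rcases (norm_nonneg v).eq_or_lt with h0 | h0
  · rw [← h0]; positivity
  · rw [sq] at hfin
    exact le_of_mul_le_mul_right hfin h0

theorem restrictedStrongConvexity_logisticLoss {s r : ℕ} {V B ω : ℝ} (hn : 0 < n)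
    (hA : TruncatedRestrictedIsometry A s (n * V) B) (hV : 0 < V) (hB : 0 ≤ B)
    (hBω : B * ω ^ 2 ≤ 1 / 1000) (hγ : 0 ≤ γ) (hr : r ≤ s) (hy : ∀ i, y i = 1 ∨ y i = -1) :
    RestrictedStrongConvexity (logisticLoss A y γ) (sparseBall d s ω) r (V / 4 + γ) := by
  have hn' : (0 : ℝ) < n := by exact_mod_cast hn
  refine ⟨fun x => (hasFDerivAt_logisticLoss A y γ x).differentiableAt, by positivity, ?_⟩
  rintro x ⟨hxs, hxω⟩ x' ⟨hxs', hxω'⟩ hxx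
  have hhs : zeroNorm (x' - x) ≤ s := by
    have h1 := zeroNorm_smul_le (-1) (x - x')
    rw [neg_one_smul, neg_sub] at h1
    exact h1.trans (hxx.trans hr)
  set h := x' - x with hh
  let G : Fin n → ℝ := fun i => logLoss (y i * rowDot A x' i) - logLoss (y i * rowDot A x i) -
    logLossDeriv (y i * rowDot A x i) * (y i * rowDot A h i)
  -- If both margins are at most `1/2`, the curvature bound gives the truncated square. Otherwise
  -- the squared margins sum to at least `1/4`, the left side is nonpositive, and convexity
  -- suffices.
  have hG : ∀ i, 1 / 4 * (min (rowDot A h i ^ 2) (B * ‖h‖ ^ 2) -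
      4 * (B * ‖h‖ ^ 2) * (rowDot A x i ^ 2 + rowDot A x' i ^ 2)) ≤ G i := by
    intro i
    have hy2 : y i ^ 2 = 1 := by rcases hy i with h | h <;> rw [h] <;> norm_num
    have hya : |y i| = 1 := by rcases hy i with h | h <;> rw [h] <;> simp
    have hd : y i * rowDot A h i = y i * rowDot A x' i - y i * rowDot A x i := by
      rw [hh, rowDot_sub]; ring
    have hBh : 0 ≤ B * ‖h‖ ^ 2 := by positivity
    have hs1 := sq_nonneg (rowDot A x i)
    have hs2 := sq_nonneg (rowDot A x' i)
    have hmin1 := min_le_left (rowDot A h i ^ 2) (B * ‖h‖ ^ 2)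
    have hmin2 := min_le_right (rowDot A h i ^ 2) (B * ‖h‖ ^ 2)
    by_cases hsmall : |rowDot A x i| ≤ 1 / 2 ∧ |rowDot A x' i| ≤ 1 / 2
    · have h1 := logLoss_bregman_ge (a := y i * rowDot A x i) (b := y i * rowDot A x' i)
        (by rw [abs_mul, hya, one_mul]; exact hsmall.1)
        (by rw [abs_mul, hya, one_mul]; exact hsmall.2)
      rw [← hd, mul_pow, hy2, one_mul] at h1
      have h2 : 0 ≤ 4 * (B * ‖h‖ ^ 2) * (rowDot A x i ^ 2 + rowDot A x' i ^ 2) := by positivity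
      simp only [G]
      linarith
    · have h1 := logLoss_bregman_nonneg (y i * rowDot A x i) (y i * rowDot A x' i)
      rw [← hd] at h1
      have h2 : 1 / 4 ≤ rowDot A x i ^ 2 + rowDot A x' i ^ 2 := by
        rw [not_and_or, not_le, not_le] at hsmall
        rw [← sq_abs (rowDot A x i), ← sq_abs (rowDot A x' i)] at *
        rcases hsmall with h | h <;> nlinarith
      have h3 := mul_le_mul_of_nonneg_left h2 hBh
      simp only [G]
      linarith
  have hsum := Finset.sum_le_sum fun i (_ : i ∈ Finset.univ) => hG i
  rw [← Finset.mul_sum, Finset.sum_sub_distrib, ← Finset.mul_sum, Finset.sum_add_distrib] at hsum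
  have hball : ∀ z, zeroNorm z ≤ s → ‖z‖ ≤ ω →
      ∑ i, rowDot A z i ^ 2 ≤ 1.36 * (n * V) * ω ^ 2 := fun z hz hzω =>
    (hA.upper z hz).trans (by gcongr)
  have hlow := hA.lower h hhs
  -- The rows with large margins cost at most `10.88 / 1000` of `n V ‖h‖²`, and `(0.52 - 0.01088) /
  -- 4 ≥ 1/8`.
  have hGsum : n * V / 8 * ‖h‖ ^ 2 ≤ ∑ i, G i := by
    have h1 := add_le_add (hball x hxs hxω) (hball x' hxs' hxω')
    have h2 := mul_le_mul_of_nonneg_left h1 (show 0 ≤ 4 * (B * ‖h‖ ^ 2) by positivity)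
    have h3 : 4 * (B * ‖h‖ ^ 2) * (1.36 * (n * V) * ω ^ 2 + 1.36 * (n * V) * ω ^ 2) =
        10.88 * (n * V * ‖h‖ ^ 2) * (B * ω ^ 2) := by ring
    have h4 := mul_le_mul_of_nonneg_left hBω (show 0 ≤ 10.88 * (n * V * ‖h‖ ^ 2) by positivity)
    have h5 : 0 ≤ n * V * ‖h‖ ^ 2 := by positivity
    linarith
  have hbreg : logisticLoss A y γ x' - logisticLoss A y γ x -
      inner ℝ (gradient (logisticLoss A y γ) x) h =
      1 / (n : ℝ) * ∑ i, G i + γ / 2 * ‖h‖ ^ 2 := by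
    rw [inner_gradient_logisticLoss, logisticLoss_eq]
    simp only [rowFunctional_apply, G, Finset.sum_sub_distrib]
    have h1 : ‖x'‖ ^ 2 = ‖x‖ ^ 2 + 2 * inner ℝ x h + ‖h‖ ^ 2 := by
      rw [← norm_add_sq_real, hh, add_sub_cancel]
    rw [h1]
    ring
  rw [hbreg]
  have h1 := mul_le_mul_of_nonneg_left hGsum (show 0 ≤ 1 / (n : ℝ) by positivity)
  have h2 : 1 / (n : ℝ) * (n * V / 8 * ‖h‖ ^ 2) = V / 8 * ‖h‖ ^ 2 := by field_simp
  linarith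

theorem restrictedConditionNumberLE_logisticLoss {s rL rα : ℕ} {V B ω : ℝ} (hn : 0 < n)
    (hA : TruncatedRestrictedIsometry A s (n * V) B) (hV : 0 < V) (hB : 0 ≤ B)
    (hBω : B * ω ^ 2 ≤ 1 / 1000) (hγ : 0 ≤ γ) (hrL : rL ≤ s) (hrα : rα ≤ s)
    (hy : ∀ i, y i = 1 ∨ y i = -1) :
    RestrictedConditionNumberLE (logisticLoss A y γ) (sparseBall d s ω) rL rα 8.16 := by
  refine ⟨1.36 * V + γ, V / 4 + γ,
    restrictedSmoothness_logisticLoss hn hA hV.le hγ hrL hy _,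
    restrictedStrongConvexity_logisticLoss hn hA hV hB hBω hγ hrα hy, ?_⟩
  rw [div_le_iff₀ (by positivity)]
  linarith

/-- On the `0`-sparse ball, which is the origin, every restricted condition number is small. -/
theorem restrictedConditionNumberLE_sparseBall_zero {ω : ℝ} (A : Matrix (Fin n) (Fin d) ℝ)
    (y : Fin n → ℝ) (γ : ℝ) (rL rα : ℕ) :
    RestrictedConditionNumberLE (logisticLoss A y γ) (sparseBall d 0 ω) rL rα 8.16 := by
  have h0 : ∀ x ∈ sparseBall d 0 ω, x = 0 := by
    rintro x ⟨hx, -⟩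
    ext j
    have := Finset.card_eq_zero.1 (Nat.le_zero.1 hx)
    simpa [supp] using Finset.filter_eq_empty_iff.1 this (Finset.mem_univ j)
  have hdiff : Differentiable ℝ (logisticLoss A y γ) :=
    fun x => (hasFDerivAt_logisticLoss A y γ x).differentiableAt
  refine ⟨0, 1, ⟨hdiff, le_rfl, ?_⟩, ⟨hdiff, one_pos, ?_⟩, by norm_num⟩
  · intro x hx x' hx' S _ _
    rw [h0 x hx, h0 x' hx', sub_self]
    simp [proj, EuclideanSpace.norm_eq]
  · intro x hx x' hx' _
    rw [h0 x hx, h0 x' hx']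
    simp

end SparseLogistic

/-! ### Union bound and choice of constants -/

namespace SparseLogistic

/-- The truncated restricted isometry holds outside of an event whose probability is
controlled by a union bound over a net. -/
theorem IsSubGaussianDesign.exists_event_truncatedRestrictedIsometry {Ω : Type*}
    [MeasurableSpace Ω] {μ : Measure Ω} [IsProbabilityMeasure μ] {n d s : ℕ}
    {A : Ω → Matrix (Fin n) (Fin d) ℝ} {σ : NNReal} {V κ : ℝ}
    (h : IsSubGaussianDesign μ A σ) (hσ : 0 < σ) (hs : 0 < s) (hsd : s ≤ d)
    (hV : ∀ i j, variance (fun w => A w i j) μ = V) (hκ : 1 ≤ κ)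
    (hσV : (σ : ℝ) ^ 2 ≤ κ * V) :
    ∃ E : Set Ω, MeasurableSet E ∧
      1 - 2 * Real.exp (102 * (s * Real.log (Real.exp 1 * d / s)) -
        1 / (10 ^ 5 * κ ^ 2) * n) ≤ μ.real E ∧
      ∀ w ∈ E, TruncatedRestrictedIsometry (A w) s (n * V) (960 * κ ^ 2 * V) := by
  have hσ' : (0 : ℝ) < σ := hσ
  have hV0 : 0 < V := by
    have : 0 < κ * V := lt_of_lt_of_le (by positivity) hσV
    exact pos_of_mul_pos_right this (by linarith)
  obtain ⟨N, hcard, hN1, hN⟩ := exists_sparse_net hs hsd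
  let U : EuclideanSpace ℝ (Fin d) → Set Ω := fun v =>
    {w | n * (V * (‖v‖ ^ 2 + 1 / 10)) ≤ ∑ i, rowDot (A w) v i ^ 2} ∪
    {w | ∑ i, min (rowDot (A w) v i ^ 2) (960 * κ ^ 2 * V) ≤ n * (V * (‖v‖ ^ 2 - 1 / 10))}
  have hmeas : ∀ v, MeasurableSet (U v) := fun v => by
    have := h.measurable_rowDot v
    refine MeasurableSet.union (measurableSet_le measurable_const ?_)
      (measurableSet_le ?_ measurable_const) <;> fun_prop
  have hbad : MeasurableSet (⋃ v ∈ N, U v) :=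
    Finset.measurableSet_biUnion N fun v _ => hmeas v
  refine ⟨(⋃ v ∈ N, U v)ᶜ, hbad.compl, ?_, ?_⟩
  · rw [probReal_compl_eq_one_sub hbad]
    have h1 : ∀ v ∈ N, μ.real (U v) ≤ 2 * Real.exp (-(1 / (10 ^ 5 * κ ^ 2) * n)) := fun v hv => by
      refine (measureReal_union_le _ _).trans ?_
      rw [two_mul]
      exact add_le_add (h.upper_tail hσ hV hκ hσV (hN1 v hv))
        (h.lower_tail hσ hV hκ hσV (hN1 v hv))
    have h2 : μ.real (⋃ v ∈ N, U v) ≤ N.card * (2 * Real.exp (-(1 / (10 ^ 5 * κ ^ 2) * n))) := by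
      rw [← nsmul_eq_mul]
      exact (measureReal_biUnion_finset_le _ _).trans (Finset.sum_le_card_nsmul _ _ _ h1)
    have h3 := mul_le_mul_of_nonneg_right hcard
      (show 0 ≤ 2 * Real.exp (-(1 / (10 ^ 5 * κ ^ 2) * n)) by positivity)
    rw [sub_eq_add_neg (102 * _), Real.exp_add]
    linarith
  · intro w hw
    have hw' : ∀ v ∈ N, w ∉ U v := fun v hv hmem => hw (Set.mem_biUnion hv hmem)
    refine TruncatedRestrictedIsometry.of_net (by positivity) (by positivity) hN hN1 ?_ ?_
    · intro v hv
      by_contra hcon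
      refine hw' v hv (Or.inl ?_)
      rw [Set.mem_ofPred_eq]
      linarith
    · intro v hv
      by_contra hcon
      refine hw' v hv (Or.inr ?_)
      rw [Set.mem_ofPred_eq]
      linarith

/-- Needed to turn smallness of `σ² ω²` into smallness of the truncation level `B ω²`, as `B` is a
multiple of `V`. -/
theorem IsSubGaussianDesign.variance_le {Ω : Type*}
    [MeasurableSpace Ω] {μ : Measure Ω} [IsProbabilityMeasure μ] {n d : ℕ}
    {A : Ω → Matrix (Fin n) (Fin d) ℝ} {σ : NNReal} (h : IsSubGaussianDesign μ A σ) (hσ : 0 < σ)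
    (i : Fin n) (j : Fin d) : variance (fun w => A w i j) μ ≤ 6 * (σ : ℝ) ^ 2 := by
  rw [variance_of_integral_eq_zero (h.measurable i j).aemeasurable (h.centered i j)]
  simpa using integral_sq_le (h.measurable i j) (by positivity) (h.subGaussian i j)

end SparseLogistic

theorem proposition12 :
    ∀ κ : ℝ, ∃ C₀ C₁ : ℝ, 0 < C₀ ∧ 0 < C₁ ∧
      ∀ (Ω : Type*) [MeasurableSpace Ω] (μ : Measure Ω) [IsProbabilityMeasure μ]
        (n d k K : ℕ) (σ : NNReal) (ω γ : ℝ)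
        (A : Ω → Matrix (Fin n) (Fin d) ℝ) (y : Ω → Fin n → ℝ),
        0 < σ → 0 < ω → 0 ≤ γ → 3 * k + K ≤ d →
        SparseLogistic.IsSubGaussianDesign μ A σ →
        (∀ i j, (σ : ℝ) ^ 2 ≤ κ * variance (fun w => A w i j) μ) →
        (∀ w i, y w i = 1 ∨ y w i = -1) →
        8 * C₁ * (3 * k + K : ℝ) * Real.log (Real.exp 1 * d / (3 * k + K : ℝ)) < (n : ℝ) →
        ∃ E : Set Ω, MeasurableSet E ∧
          1 - Real.exp (1 - C₀ / ((σ : ℝ) ^ 2 * ω ^ 2)) - 2 * Real.exp (-(n : ℝ) / (8 * C₁))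
            ≤ μ.real E ∧
          ∀ w ∈ E, SparseLogistic.RestrictedConditionNumberLE
            (SparseLogistic.logisticLoss (A w) (y w) γ)
            (SparseLogistic.sparseBall d (3 * k + K) ω) (2 * k + K) (k + K) 8.16 := by
  intro κ₀
  -- Enlarging `κ` only weakens the variance hypothesis, and the tail bounds need `κ ≥ 1`.
  obtain ⟨κ, hκ⟩ : ∃ κ : ℝ, κ = max κ₀ 1 := ⟨_, rfl⟩
  have hκ1 : 1 ≤ κ := hκ ▸ le_max_right _ _
  have hκ0 : κ₀ ≤ κ := hκ ▸ le_max_left _ _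
  refine ⟨1 / (10 ^ 7 * κ ^ 2), 13 * 10 ^ 5 * κ ^ 2, by positivity, by positivity, ?_⟩
  intro Ω _ μ _ n d k K σ ω γ A y hσ hω hγ hd hA hvar hy hn
  have hσ' : (0 : ℝ) < σ := hσ
  obtain ⟨s, hs⟩ : ∃ s : ℕ, s = 3 * k + K := ⟨_, rfl⟩
  have hscast : (3 * k + K : ℝ) = s := by rw [hs]; push_cast; ring
  rw [hscast] at hn
  rw [← hs] at hd ⊢
  have hlog0 : 0 ≤ (s : ℝ) * Real.log (Real.exp 1 * d / s) := by
    rcases Nat.eq_zero_or_pos s with h0 | h0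
    · simp [h0]
    · have h1 : (0 : ℝ) < s := by exact_mod_cast h0
      have h2 : (s : ℝ) ≤ d := by exact_mod_cast hd
      refine mul_nonneg h1.le (Real.log_nonneg ?_)
      rw [le_div_iff₀ h1]
      nlinarith [Real.add_one_le_exp (1 : ℝ)]
  have hn0 : (0 : ℝ) < n := by
    refine lt_of_le_of_lt ?_ hn
    rw [mul_assoc]
    positivity
  have hnpos : 0 < n := by exact_mod_cast hn0
  rcases Nat.eq_zero_or_pos s with hs0 | hs0
  · refine ⟨Set.univ, MeasurableSet.univ, ?_, fun w _ => ?_⟩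
    · rw [probReal_univ]
      have h1 := Real.exp_pos (1 - 1 / (10 ^ 7 * κ ^ 2) / ((σ : ℝ) ^ 2 * ω ^ 2))
      have h2 := Real.exp_pos (-(n : ℝ) / (8 * (13 * 10 ^ 5 * κ ^ 2)))
      linarith
    · rw [hs0]
      exact SparseLogistic.restrictedConditionNumberLE_sparseBall_zero _ _ _ _ _
  have hdpos : 0 < d := hs0.trans_le hd
  -- If the quotient is below `1`, the claimed probability is negative and the empty event will do.
  rcases lt_or_ge (1 / (10 ^ 7 * κ ^ 2) / ((σ : ℝ) ^ 2 * ω ^ 2)) 1 with hbig | hsmall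
  · refine ⟨∅, MeasurableSet.empty, ?_, fun w hw => absurd hw (Set.notMem_empty w)⟩
    rw [measureReal_empty]
    have h1 := Real.one_le_exp (sub_pos.2 hbig).le
    have h2 := Real.exp_pos (-(n : ℝ) / (8 * (13 * 10 ^ 5 * κ ^ 2)))
    linarith
  obtain ⟨V, hVdef⟩ : ∃ V : ℝ, V = variance (fun w => A w ⟨0, hnpos⟩ ⟨0, hdpos⟩) μ := ⟨_, rfl⟩
  have hV : ∀ i j, variance (fun w => A w i j) μ = V := fun i j => by
    rw [hVdef]
    exact (hA.identDistrib (i, j) (⟨0, hnpos⟩, ⟨0, hdpos⟩)).variance_eq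
  have hVnn : 0 ≤ V := hVdef ▸ variance_nonneg _ _
  have hσV : (σ : ℝ) ^ 2 ≤ κ * V := by
    have h1 := hvar ⟨0, hnpos⟩ ⟨0, hdpos⟩
    rw [hV] at h1
    exact h1.trans (mul_le_mul_of_nonneg_right hκ0 hVnn)
  have hVσ : V ≤ 6 * (σ : ℝ) ^ 2 := hVdef ▸ hA.variance_le hσ _ _
  have hV0 : 0 < V := by
    have : 0 < κ * V := lt_of_lt_of_le (by positivity) hσV
    exact pos_of_mul_pos_right this (by linarith)
  obtain ⟨E, hE, hprob, hgood⟩ :=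
    hA.exists_event_truncatedRestrictedIsometry hσ hs0 hd hV hκ1 hσV
  refine ⟨E, hE, le_trans ?_ hprob, fun w hw => ?_⟩
  · have h1 := Real.exp_pos (1 - 1 / (10 ^ 7 * κ ^ 2) / ((σ : ℝ) ^ 2 * ω ^ 2))
    have h2 : Real.exp (102 * (s * Real.log (Real.exp 1 * d / s)) - 1 / (10 ^ 5 * κ ^ 2) * n) ≤
        Real.exp (-(n : ℝ) / (8 * (13 * 10 ^ 5 * κ ^ 2))) := by
      apply Real.exp_le_exp.2
      have h3 : (s : ℝ) * Real.log (Real.exp 1 * d / s) ≤ n / (8 * (13 * 10 ^ 5 * κ ^ 2)) := by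
        rw [le_div_iff₀ (by positivity)]
        linarith
      -- `C₁` is tuned so that the tail exponent is `104` units of `n / (8 C₁)`, of which the net
      -- takes at most `102`.
      have h4 : 1 / (10 ^ 5 * κ ^ 2) * n = 104 * (n / (8 * (13 * 10 ^ 5 * κ ^ 2))) := by
        field_simp; norm_num
      have h5 : 0 ≤ (n : ℝ) / (8 * (13 * 10 ^ 5 * κ ^ 2)) := by positivity
      rw [h4, neg_div]
      linarith
    linarith
  · refine SparseLogistic.restrictedConditionNumberLE_logisticLoss hnpos (hgood w hw) hV0
      (by positivity) ?_ hγ (by omega) (by omega) (hy w)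
    -- Here `B ω² ≤ 960 * 6 κ² σ² ω² ≤ 5760 / 10⁷`, below the required `1/1000`.
    rw [le_div_iff₀ (by positivity), le_div_iff₀ (by positivity)] at hsmall
    have h1 := mul_le_mul_of_nonneg_left hVσ (show 0 ≤ 960 * κ ^ 2 * ω ^ 2 by positivity)
    linarith
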